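/- Let $\mu$ be the uniform measure on Cantor space $2^\omega$. For a finite string $\tau\in 2^{<\omega}$ let $[\tau]$ be the set of $X\in 2^\omega$ extending $\tau$, and for measurable $P\subseteq 2^\omega$ and $X\in 2^\omega$ put $\mu_\tau(P)=\mu(P\cap[\tau])/\mu([\tau])$ and $\rho(P\mid X)=\liminf_{i\to\infty}\mu_{X\upharpoonright i}(P)$, where $X\upharpoonright i$ is the initial segment of $X$ of length $i$. Subsets of $\mathbb{N}$ are identified with elements of $2^\omega$. A $\Pi^0_1$ class is the complement of a set $\bigcup_{\sigma\in W}[\sigma]$ with $W\subseteq 2^{<\omega}$ computably enumerable. Call $X$ a density-one point if $\rho(P\mid X)=1$ for every $\Pi^0_1$ class $P$ containing $X$, and a positive density point if $\rho(P\mid X)>0$ for every $\Pi^0_1$ class $P$ containing $X$. **Theorem.** There is a $\Delta^0_2$ set $X$ such that 1. $X$ is Martin-Löf random; 2. $X$ is not a density-one point; moreover, there is a $\Pi^0_1$ class $P$ with $X\in P$, all of whose elements are Martin-Löf random, such that $\rho(P\mid X)\le 1/2$; 3. $X$ is a positive density point. -/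

import Mathlib

open MeasureTheory Filter
open scoped ENNReal

noncomputable section

namespace Cantor

/-- Cantor space `2^ω`. A point `X` is identified with the set `{n | X n = true}`. -/
abbrev Space : Type := ℕ → Bool

/-- The fair coin measure on `{0, 1}`. -/
def coin : Measure Bool := (PMF.uniformOfFintype Bool).toMeasure

instance : IsProbabilityMeasure coin := by
  unfold coin
  infer_instance

/-- The uniform measure on Cantor space: the product of countably many fair coins. -/
def measure : Measure Space := Measure.infinitePi fun _ : ℕ => coin

/-- The finite string `X(0) X(1) … X(n-1)`. -/
def restrict (X : Space) (n : ℕ) : List Bool := (List.range n).map X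

/-- The basic clopen set `[σ]` of all infinite sequences that extend the finite string `σ`. -/
def basicOpen (σ : List Bool) : Set Space := {X | restrict X σ.length = σ}

/-- The open set `⋃_{σ ∈ W} [σ]` generated by a set `W` of finite strings. -/
def openSet (W : Set (List Bool)) : Set Space := ⋃ σ ∈ W, basicOpen σ

/-- `P` is a `Π⁰₁` class: its complement is the open set generated by a computably
enumerable set of finite strings. -/
def IsPi01Class (P : Set Space) : Prop :=
  ∃ W : Set (List Bool), REPred (fun σ => σ ∈ W) ∧ P = (openSet W)ᶜ

/-- `U` is a Martin-Löf test: a sequence of uniformly `Σ⁰₁` open sets such that the `n`th one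
has measure at most `2⁻ⁿ`. -/
def IsMLTest (U : ℕ → Set Space) : Prop :=
  (∃ W : ℕ → Set (List Bool),
    REPred (fun p : ℕ × List Bool => p.2 ∈ W p.1) ∧ ∀ n, U n = openSet (W n)) ∧
  ∀ n, measure (U n) ≤ (2⁻¹ : ℝ≥0∞) ^ n

/-- `X` is Martin-Löf random: it passes every Martin-Löf test. -/
def IsMLRandom (X : Space) : Prop :=
  ∀ U : ℕ → Set Space, IsMLTest U → X ∉ ⋂ n, U n

/-- `μ_τ(P) = μ(P ∩ [τ]) / μ([τ])`. -/
def relMeasure (τ : List Bool) (P : Set Space) : ℝ≥0∞ :=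
  measure (P ∩ basicOpen τ) / measure (basicOpen τ)

/-- The lower density `ρ(P ∣ X) = liminf_i μ_{X ↾ i}(P)`. -/
def lowerDensity (P : Set Space) (X : Space) : ℝ≥0∞ :=
  liminf (fun i : ℕ => relMeasure (restrict X i) P) atTop

/-- `X` is a density-one point: `ρ(P ∣ X) = 1` for every `Π⁰₁` class `P` containing `X`. -/
def IsDensityOnePoint (X : Space) : Prop :=
  ∀ P : Set Space, IsPi01Class P → X ∈ P → lowerDensity P X = 1

/-- `X` is a positive density point: `ρ(P ∣ X) > 0` for every `Π⁰₁` class `P` containing `X`. -/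
def IsPositiveDensityPoint (X : Space) : Prop :=
  ∀ P : Set Space, IsPi01Class P → X ∈ P → 0 < lowerDensity P X

/-- `A ⊆ ℕ` is `Σ⁰₂`: `n ∈ A ↔ ∃ a, ∀ b, R(n, a, b)` for a computable relation `R`. -/
def IsSigma02 (A : Set ℕ) : Prop :=
  ∃ R : ℕ × ℕ × ℕ → Prop, ComputablePred R ∧ ∀ n, n ∈ A ↔ ∃ a, ∀ b, R (n, a, b)

/-- `A ⊆ ℕ` is `Δ⁰₂`: both `A` and its complement are `Σ⁰₂`. -/
def IsDelta02 (A : Set ℕ) : Prop := IsSigma02 A ∧ IsSigma02 Aᶜ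

end Cantor

end

/-! `X` is the limit of a forcing construction with finite injury, run effectively in `0′`. The
class `P` is `treeClass randTree`, the complement of a universal Martin-Löf test. A condition is a
pair `(σ, a)`: `σ` is an initial segment of `X`, and `a` says for finitely many `e` whether the
`e`-th `Π⁰₁` class is on or off. An off class has already been left by `σ`; an on class must keep
relative measure at least `2^-(e+3)` from `σ` onwards. The paths in `P` through `σ` obeying the
on-requirements form `condClass σ a`, itself a `Π⁰₁` class, which must stay nonempty.

A step is always possible (`exists_switch`). If some `e ≤ |a|` is not off and its class fails to
contain `condClass σ (a.take e)`, then extend `σ` so as to leave that class, switch `e` off and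
cancel all decisions above `e`. Otherwise use `exists_sparse_extension`. The leftmost path `Z` of
`condClass σ a` is random, so it contains a block `111` just after some `ρ ≺ Z` longer than `σ`.
Being leftmost forces `condClass σ a ∩ [ρ] ⊆ [ρ111]`, of relative measure at most `1/8`. The
on-requirements remove from `P ∩ [ρ]` relative measure at most `∑ 2^-(e+3) ≤ 1/4`: the points lost
to class `e` lie in that class, and are covered by strings where it is thin. So `P` has relative
measure below `1/2` at `ρ`. Some `τ` above `ρ` gives `condClass σ a` relative measure above
`2^-(|a|+3)`, which leaves room to switch on the next class at `τ`.

Each decision changes finitely often (`exists_stable`). A class containing `X` cannot end up off, so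
its indices end up on, which bounds its lower density away from `0`. Since every class has
infinitely many indices, switching on happens infinitely often, and `P` has lower density at most
`1/2` at `X`. Finally, the relation between successive conditions is a Boolean combination of `Σ⁰₁`
facts, by compactness and by approximating measures from above; `exists_limit_sequence` then makes
`X` a `Δ⁰₂` set. -/

noncomputable section

namespace Cantor

/-! ### Closure properties of primitive recursive predicates -/

open Classical in
theorem primrec_count {α β : Type*} [Primcodable α] [Primcodable β] {R : α → β → Prop}
    (hR : PrimrecPred fun q : α × β => R q.1 q.2) {f : α → List β} (hf : Primrec f) :
    Primrec fun a => ((f a).filter fun b => decide (R a b)).length := by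
  have h : PrimrecRel fun (b : β) (a : α) => R a b := hR.comp (Primrec.snd.pair Primrec.fst)
  exact Primrec.list_length.comp (h.listFilter.comp hf Primrec.id)

theorem primrecPred_forall_lt {α : Type*} [Primcodable α] {p : α → ℕ → Prop}
    (hp : PrimrecPred fun q : α × ℕ => p q.1 q.2) {f : α → ℕ} (hf : Primrec f) :
    PrimrecPred fun a => ∀ m < f a, p a m := by
  have h : PrimrecRel fun (m : ℕ) (a : α) => p a m := hp.comp (Primrec.snd.pair Primrec.fst)
  exact (h.forall_mem_list.comp (Primrec.list_range.comp hf) Primrec.id).of_eq fun _ => by simp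

theorem primrecPred_exists_lt {α : Type*} [Primcodable α] {p : α → ℕ → Prop}
    (hp : PrimrecPred fun q : α × ℕ => p q.1 q.2) {f : α → ℕ} (hf : Primrec f) :
    PrimrecPred fun a => ∃ m < f a, p a m := by
  have h : PrimrecRel fun (m : ℕ) (a : α) => p a m := hp.comp (Primrec.snd.pair Primrec.fst)
  exact (h.exists_mem_list.comp (Primrec.list_range.comp hf) Primrec.id).of_eq fun _ => by simp

theorem primrecPred_forall_le {α : Type*} [Primcodable α] {p : α → ℕ → Prop}
    (hp : PrimrecPred fun q : α × ℕ => p q.1 q.2) {f : α → ℕ} (hf : Primrec f) :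
    PrimrecPred fun a => ∀ m ≤ f a, p a m :=
  (primrecPred_forall_lt hp (Primrec.succ.comp hf)).of_eq fun _ => by simp

theorem primrecPred_exists_le {α : Type*} [Primcodable α] {p : α → ℕ → Prop}
    (hp : PrimrecPred fun q : α × ℕ => p q.1 q.2) {f : α → ℕ} (hf : Primrec f) :
    PrimrecPred fun a => ∃ m ≤ f a, p a m :=
  (primrecPred_exists_lt hp (Primrec.succ.comp hf)).of_eq fun _ => by simp

theorem primrecPred_imp {α : Type*} [Primcodable α] {p q : α → Prop}
    (hp : PrimrecPred p) (hq : PrimrecPred q) : PrimrecPred fun a => p a → q a :=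
  (hp.not.or hq).of_eq fun _ => by tauto

theorem primrec_two_pow {α : Type*} [Primcodable α] {f : α → ℕ} (hf : Primrec f) :
    Primrec fun a => 2 ^ f a := by
  have h : Primrec fun n : ℕ => 2 ^ n :=
    (Primrec.nat_rec₁ 1 (f := fun _ m => 2 * m)
      ((Primrec.nat_mul.comp (Primrec.const 2) Primrec.snd).to₂)).of_eq fun n => by
        induction n with
        | zero => rfl
        | succ n ih => simp only [ih]; ring
  exact h.comp hf

/-! ### Searches relative to a limit-decidable relation -/

open Classical in
/-- The first element, in the order of codes below `s`, related to `x` at stage `s`;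
it is `x` if there is none. -/
def firstRelated {α : Type*} [Primcodable α] (Ds : α → α → ℕ → Prop) (s : ℕ) (x : α) : α :=
  ((((List.range s).filterMap fun n => (Encodable.decode n : Option α)).filter
    fun y => decide (Ds x y s)).head?).getD x

theorem primrec_firstRelated {α : Type*} [Primcodable α] {Ds : α → α → ℕ → Prop}
    (hD : PrimrecPred fun q : α × α × ℕ => Ds q.1 q.2.1 q.2.2) :
    Primrec₂ (firstRelated Ds) := by
  classical
  have h : PrimrecRel fun (y : α) (q : ℕ × α) => Ds q.2 y q.1 :=
    hD.comp ((Primrec.snd.comp Primrec.snd).pair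
      (Primrec.fst.pair (Primrec.fst.comp Primrec.snd)))
  have h1 : Primrec fun q : ℕ × α =>
      (List.range q.1).filterMap fun n => (Encodable.decode n : Option α) :=
    Primrec.listFilterMap (Primrec.list_range.comp Primrec.fst)
      (Primrec.decode.comp Primrec.snd).to₂
  exact Primrec.option_getD.comp
    (Primrec.list_head?.comp (h.listFilter.comp h1 Primrec.id)) Primrec.snd

theorem exists_eventually_firstRelated {α : Type*} [Primcodable α] {Ds : α → α → ℕ → Prop}
    {D : α → α → Prop} (hlim : ∀ x y, ∀ᶠ s in atTop, (Ds x y s ↔ D x y)) {x : α}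
    (hx : ∃ y, D x y) : ∃ y, D x y ∧ ∀ᶠ s in atTop, firstRelated Ds s x = y := by
  classical
  have hex : ∃ n, ∃ y : α, Encodable.decode n = some y ∧ D x y := by
    obtain ⟨y, hy⟩ := hx
    exact ⟨Encodable.encode y, y, Encodable.encodek y, hy⟩
  obtain ⟨y, hy, hDy⟩ := Nat.find_spec hex
  have hmin := fun m (hm : m < Nat.find hex) => Nat.find_min hex hm
  set n := Nat.find hex
  refine ⟨y, hDy, ?_⟩
  -- Only the finitely many codes up to the least correct one matter, so a single stage settles them
  -- all.
  have hev : ∀ᶠ s in atTop, ∀ m ∈ Set.Iic n, ∀ z : α, Encodable.decode m = some z →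
      (Ds x z s ↔ D x z) := by
    rw [eventually_all_finite (Set.finite_Iic n)]
    intro m _
    rcases hdec : (Encodable.decode m : Option α) with _ | z
    · simp
    · filter_upwards [hlim x z] with s hs w hw
      cases hw
      exact hs
  filter_upwards [hev, eventually_gt_atTop n] with s hs hns
  have hsplit : List.range s = List.range n ++ n :: (List.range (s - (n + 1))).map (n + 1 + ·) := by
    conv_lhs => rw [show s = (n + 1) + (s - (n + 1)) by omega]
    rw [List.range_add, List.range_succ]
    simp
  have hnil : (((List.range n).filterMap fun n => (Encodable.decode n : Option α)).filter
      fun y => decide (Ds x y s)) = [] := by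
    rw [List.filter_eq_nil_iff]
    intro z hz
    obtain ⟨m, hm, hmz⟩ := List.mem_filterMap.1 hz
    have hm' := List.mem_range.1 hm
    simp only [decide_eq_true_eq]
    intro hD
    exact hmin m hm' ⟨z, hmz, (hs m (le_of_lt hm') z hmz).1 hD⟩
  have hDs : Ds x y s := (hs n (Set.mem_Iic.2 le_rfl) y hy).2 hDy
  unfold firstRelated
  rw [hsplit, List.filterMap_append, List.filter_append, hnil, List.filterMap_cons_some hy,
    List.filter_cons_of_pos (by simpa using hDs)]
  simp

/-- A search construction relative to a limit-decidable relation can be approximated by a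
primitive recursive function that stabilises at every step. -/
theorem exists_limit_sequence {α : Type*} [Primcodable α] {Ds : α → α → ℕ → Prop}
    (hD : PrimrecPred fun q : α × α × ℕ => Ds q.1 q.2.1 q.2.2)
    {D : α → α → Prop} (hlim : ∀ x y, ∀ᶠ s in atTop, (Ds x y s ↔ D x y))
    {Inv : α → Prop} (hex : ∀ x, Inv x → ∃ y, D x y) (hinv : ∀ x y, Inv x → D x y → Inv y)
    {x₀ : α} (h₀ : Inv x₀) :
    ∃ st : ℕ → α, st 0 = x₀ ∧ (∀ k, Inv (st k)) ∧ (∀ k, D (st k) (st (k + 1))) ∧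
      ∃ g : ℕ → ℕ → α, Primrec₂ g ∧ ∀ k, ∀ᶠ s in atTop, g k s = st k := by
  have key : ∀ x : {x // Inv x}, ∃ y : {y // Inv y}, D x y ∧
      ∀ᶠ s in atTop, firstRelated Ds s x.1 = y.1 := fun x => by
    obtain ⟨y, hy, h⟩ := exists_eventually_firstRelated hlim (hex x.1 x.2)
    exact ⟨⟨y, hinv _ _ x.2 hy⟩, hy, h⟩
  choose F hF hFlim using key
  let st : ℕ → {x // Inv x} := fun k => F^[k] ⟨x₀, h₀⟩
  have hst : ∀ k, st (k + 1) = F (st k) := fun k => Function.iterate_succ_apply' F k _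
  refine ⟨fun k => (st k).1, rfl, fun k => (st k).2, fun k => ?_,
    fun k s => (firstRelated Ds s)^[k] x₀, ?_, fun k => ?_⟩
  · simpa only [hst] using hF (st k)
  · have h : Primrec fun q : ℕ × ℕ => (firstRelated Ds q.2)^[q.1] x₀ :=
      Primrec.nat_iterate Primrec.fst (Primrec.const x₀)
        ((primrec_firstRelated hD).comp (Primrec.snd.comp Primrec.fst) Primrec.snd).to₂
    exact h
  · induction k with
    | zero => simp [st]
    | succ k ih =>
      filter_upwards [ih, hFlim (st k)] with s h1 h2
      rw [Function.iterate_succ_apply', h1, h2, hst]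

/-- A set with a primitive recursive approximation is `Δ⁰₂`. -/
theorem isDelta02_of_limit {A : Set ℕ} {p : ℕ → ℕ → Prop}
    (hp : PrimrecPred fun q : ℕ × ℕ => p q.1 q.2)
    (hlim : ∀ n, ∀ᶠ s in atTop, (p n s ↔ n ∈ A)) : IsDelta02 A := by
  have main : ∀ (A : Set ℕ) (p : ℕ → ℕ → Prop), (PrimrecPred fun q : ℕ × ℕ => p q.1 q.2) →
      (∀ n, ∀ᶠ s in atTop, (p n s ↔ n ∈ A)) → IsSigma02 A := by
    intro A p hp hlim
    -- The existential witness is a stage from which the approximation always answers yes.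
    refine ⟨fun q => q.2.1 ≤ q.2.2 → p q.1 q.2.2, ?_, fun n => ?_⟩
    · refine PrimrecPred.computablePred (primrecPred_imp ?_ ?_)
      · exact Primrec.nat_le.comp (Primrec.fst.comp Primrec.snd) (Primrec.snd.comp Primrec.snd)
      · exact hp.comp (Primrec.fst.pair (Primrec.snd.comp Primrec.snd))
    · obtain ⟨a, ha⟩ := eventually_atTop.1 (hlim n)
      constructor
      · exact fun hn => ⟨a, fun b hb => (ha b hb).2 hn⟩
      · rintro ⟨c, hc⟩
        exact (ha (max a c) (le_max_left _ _)).1 (hc _ (le_max_right _ _))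
  refine ⟨main A p hp hlim, main Aᶜ (fun n s => ¬ p n s) hp.not fun n => ?_⟩
  filter_upwards [hlim n] with s hs
  simp [hs]

/-! ### Strings, cylinders and their measure -/

@[simp] theorem length_restrict (X : Space) (n : ℕ) : (restrict X n).length = n := by
  simp [restrict]

theorem restrict_succ (X : Space) (n : ℕ) : restrict X (n + 1) = restrict X n ++ [X n] := by
  simp [restrict, List.range_succ]

theorem take_restrict (X : Space) {i n : ℕ} (h : i ≤ n) :
    (restrict X n).take i = restrict X i := by
  simp [restrict, ← List.map_take, List.take_range, Nat.min_eq_left h]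

theorem restrict_prefix (X : Space) {i n : ℕ} (h : i ≤ n) : restrict X i <+: restrict X n := by
  rw [← take_restrict X h]
  exact List.take_prefix _ _

theorem getElem_restrict (X : Space) {i n : ℕ} (h : i < (restrict X n).length) :
    (restrict X n)[i] = X i := by
  simp [restrict]

theorem restrict_eq_iff {X : Space} {τ : List Bool} :
    restrict X τ.length = τ ↔ ∀ i, (h : i < τ.length) → X i = τ[i] := by
  constructor
  · intro h i hi
    have h2 : (restrict X τ.length)[i]'(by simpa using hi) = τ[i] := by
      simp only [h]
    rw [← h2, getElem_restrict]
  · intro h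
    refine List.ext_getElem (by simp) fun i h1 h2 => ?_
    rw [getElem_restrict, h i h2]

theorem mem_basicOpen {X : Space} {τ : List Bool} : X ∈ basicOpen τ ↔ restrict X τ.length = τ :=
  Iff.rfl

theorem mem_basicOpen_restrict (X : Space) (n : ℕ) : X ∈ basicOpen (restrict X n) := by
  simp [mem_basicOpen]

theorem basicOpen_anti {σ τ : List Bool} (h : σ <+: τ) : basicOpen τ ⊆ basicOpen σ := by
  intro X hX
  rw [mem_basicOpen] at *
  rw [← take_restrict X h.length_le, hX, ← List.prefix_iff_eq_take.1 h]

theorem basicOpen_nonempty (τ : List Bool) : (basicOpen τ).Nonempty :=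
  ⟨fun i => τ.getD i false, restrict_eq_iff.2 fun i hi => by simp [hi]⟩

theorem prefix_of_mem_basicOpen {X : Space} {σ τ : List Bool} (hσ : X ∈ basicOpen σ)
    (hτ : X ∈ basicOpen τ) (h : σ.length ≤ τ.length) : σ <+: τ := by
  rw [mem_basicOpen] at *
  rw [← hσ, ← hτ]
  exact restrict_prefix X h

theorem basicOpen_eq_pi (τ : List Bool) : basicOpen τ =
    Set.pi (Finset.range τ.length) fun i => {τ.getD i false} := by
  ext X
  rw [mem_basicOpen, restrict_eq_iff]
  simp only [Set.mem_pi, Finset.coe_range, Set.mem_Iio, Set.mem_singleton_iff]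
  exact forall₂_congr fun i hi => by simp [hi]

theorem measurableSet_basicOpen (τ : List Bool) : MeasurableSet (basicOpen τ) := by
  rw [basicOpen_eq_pi]
  exact MeasurableSet.pi (Finset.countable_toSet _) fun i _ => measurableSet_singleton _

theorem isClosed_basicOpen (τ : List Bool) : IsClosed (basicOpen τ) := by
  rw [basicOpen_eq_pi]
  exact isClosed_set_pi fun i _ => isClosed_singleton

instance : IsProbabilityMeasure measure := by
  unfold measure
  infer_instance

theorem coin_singleton (b : Bool) : coin {b} = 2⁻¹ := by
  simp [coin]

theorem measure_basicOpen (τ : List Bool) : measure (basicOpen τ) = (2 ^ τ.length)⁻¹ := by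
  rw [basicOpen_eq_pi, measure, Measure.infinitePi_pi _ fun i _ => measurableSet_singleton _]
  simp [coin_singleton, ENNReal.inv_pow]

/-- The list of all strings of length `s`. -/
def strings : ℕ → List (List Bool)
  | 0 => [[]]
  | s + 1 => (strings s).flatMap fun v => [v ++ [false], v ++ [true]]

theorem mem_strings {s : ℕ} {v : List Bool} : v ∈ strings s ↔ v.length = s := by
  induction s generalizing v with
  | zero => simp [strings]
  | succ s ih =>
    simp only [strings, List.mem_flatMap, ih, List.mem_cons, List.not_mem_nil, or_false]
    constructor
    · rintro ⟨w, hw, rfl | rfl⟩ <;> simp [hw]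
    · intro h
      rcases List.eq_nil_or_concat v with rfl | ⟨w, b, rfl⟩
      · simp at h
      · refine ⟨w, by simpa using h, ?_⟩
        cases b <;> simp

theorem nodup_strings (s : ℕ) : (strings s).Nodup := by
  induction s with
  | zero => simp [strings]
  | succ s ih =>
    rw [strings, List.nodup_flatMap]
    refine ⟨fun v _ => by simp, ih.imp fun {v w} hvw => ?_⟩
    simp only [Function.onFun, List.disjoint_left, List.mem_cons, List.not_mem_nil, or_false]
    rintro u (rfl | rfl) (h | h) <;> simp_all

theorem primrec_strings : Primrec strings := by
  have h1 : Primrec₂ fun (_ : ℕ) (l : List (List Bool)) =>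
      l.flatMap fun v => [v ++ [false], v ++ [true]] := by
    refine Primrec.list_flatMap Primrec.snd ?_
    have h2 : ∀ b : Bool, Primrec fun q : (ℕ × List (List Bool)) × List Bool => q.2 ++ [b] :=
      fun b => Primrec.list_append.comp Primrec.snd (Primrec.const [b])
    exact Primrec.list_cons.comp (h2 false) (Primrec.list_cons.comp (h2 true) (Primrec.const []))
  exact (Primrec.nat_rec₁ [[]] h1).of_eq fun n => by
    induction n with
    | zero => rfl
    | succ n ih => simp only [strings, ← ih]

open Classical in
/-- The number of strings of length `s` satisfying `p`. -/
def count (p : List Bool → Prop) (s : ℕ) : ℕ := ((strings s).filter fun v => decide (p v)).length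

theorem setOf_restrict_eq_biUnion (p : List Bool → Prop) (s : ℕ) :
    {X : Space | p (restrict X s)} = ⋃ v ∈ {v : List Bool | v.length = s ∧ p v}, basicOpen v := by
  ext X
  simp only [Set.mem_ofPred_eq, Set.mem_iUnion, exists_prop]
  constructor
  · exact fun h => ⟨restrict X s, ⟨by simp, h⟩, mem_basicOpen_restrict X s⟩
  · rintro ⟨v, ⟨rfl, hv⟩, hX⟩
    rwa [mem_basicOpen.1 hX]

theorem finite_setOf_length (p : List Bool → Prop) (s : ℕ) :
    {v : List Bool | v.length = s ∧ p v}.Finite :=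
  (List.finite_length_eq Bool s).subset fun _ h => h.1

theorem isClosed_setOf_restrict (p : List Bool → Prop) (s : ℕ) :
    IsClosed {X : Space | p (restrict X s)} := by
  rw [setOf_restrict_eq_biUnion]
  exact (finite_setOf_length p s).isClosed_biUnion fun v _ => isClosed_basicOpen v

theorem disjoint_basicOpen_of_length {v w : List Bool} (h : v.length = w.length) (hne : v ≠ w) :
    Disjoint (basicOpen v) (basicOpen w) := by
  rw [Set.disjoint_left]
  intro X hv hw
  apply hne
  rw [← mem_basicOpen.1 hv, ← mem_basicOpen.1 hw, h]

theorem measure_setOf_restrict (p : List Bool → Prop) (s : ℕ) :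
    measure {X : Space | p (restrict X s)} = count p s * (2 ^ s)⁻¹ := by
  classical
  have h : {X : Space | p (restrict X s)} =
      ⋃ v ∈ ((strings s).filter fun v => decide (p v)).toFinset, basicOpen v := by
    rw [setOf_restrict_eq_biUnion]
    simp [mem_strings]
  rw [h, measure_biUnion_finset]
  · rw [Finset.sum_congr rfl (g := fun _ => (2 ^ s : ℝ≥0∞)⁻¹)]
    · rw [Finset.sum_const, nsmul_eq_mul, List.toFinset_card_of_nodup ((nodup_strings s).filter _)]
      rfl
    · intro v hv
      have hv' : v.length = s := by
        simpa [mem_strings] using (List.mem_filter.1 (List.mem_toFinset.1 hv)).1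
      rw [measure_basicOpen, hv']
  · intro v hv w hw hne
    have h1 := mem_strings.1 (List.mem_filter.1 (List.mem_toFinset.1 hv)).1
    have h2 := mem_strings.1 (List.mem_filter.1 (List.mem_toFinset.1 hw)).1
    exact disjoint_basicOpen_of_length (h1.trans h2.symm) hne
  · exact fun v _ => measurableSet_basicOpen v

theorem natCast_mul_inv_two_pow_lt {c s k : ℕ} :
    (c : ℝ≥0∞) * (2 ^ s)⁻¹ < (2 ^ k)⁻¹ ↔ c * 2 ^ k < 2 ^ s := by
  have h2 : ∀ n : ℕ, (2 : ℝ≥0∞) ^ n ≠ 0 := fun n => by positivity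
  have h3 : ∀ n : ℕ, (2 : ℝ≥0∞) ^ n ≠ ∞ := fun n => by simp
  rw [← div_eq_mul_inv, ENNReal.div_lt_iff (Or.inl (h2 s)) (Or.inl (h3 s)), mul_comm _ (2 ^ s),
    ← div_eq_mul_inv, ENNReal.lt_div_iff_mul_lt (Or.inl (h2 k)) (Or.inl (h3 k))]
  exact_mod_cast Iff.rfl

/-! ### Classes of paths and their clopen approximations -/

/-- The class of paths through `T`. -/
def treeClass (T : List Bool → Prop) : Set Space := {X | ∀ n, T (restrict X n)}

/-- All initial segments of the string satisfy `T`. -/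
def Good (T : List Bool → Prop) (v : List Bool) : Prop := ∀ i ≤ v.length, T (v.take i)

/-- The clopen approximation to `treeClass T` at height `s`. -/
def level (T : List Bool → Prop) (s : ℕ) : Set Space := {X | ∀ i ≤ s, T (restrict X i)}

theorem level_eq (T : List Bool → Prop) (s : ℕ) : level T s = {X | Good T (restrict X s)} := by
  ext X
  simp only [level, Good, Set.mem_ofPred_eq, length_restrict]
  exact forall₂_congr fun i hi => by rw [take_restrict X hi]

theorem level_anti (T : List Bool → Prop) : Antitone (level T) :=
  fun _ _ h _ hX i hi => hX i (hi.trans h)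

theorem iInter_level (T : List Bool → Prop) : ⋂ s, level T s = treeClass T := by
  ext X
  simp only [Set.mem_iInter, level, treeClass, Set.mem_ofPred_eq]
  exact ⟨fun h n => h n n le_rfl, fun h _ i _ => h i⟩

theorem treeClass_subset_level (T : List Bool → Prop) (s : ℕ) : treeClass T ⊆ level T s :=
  fun _ hX i _ => hX i

theorem isClosed_level (T : List Bool → Prop) (s : ℕ) : IsClosed (level T s) := by
  rw [level_eq]
  exact isClosed_setOf_restrict _ _

theorem isClosed_treeClass (T : List Bool → Prop) : IsClosed (treeClass T) := by
  rw [← iInter_level]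
  exact isClosed_iInter (isClosed_level T)

theorem measurableSet_level (T : List Bool → Prop) (s : ℕ) : MeasurableSet (level T s) :=
  (isClosed_level T s).measurableSet

theorem measurableSet_treeClass (T : List Bool → Prop) : MeasurableSet (treeClass T) :=
  (isClosed_treeClass T).measurableSet

theorem measure_level (T : List Bool → Prop) (s : ℕ) :
    measure (level T s) = count (Good T) s * (2 ^ s)⁻¹ := by
  rw [level_eq, measure_setOf_restrict]

theorem measure_treeClass (T : List Bool → Prop) :
    measure (treeClass T) = ⨅ s, measure (level T s) := by
  rw [← iInter_level]
  exact (level_anti T).measure_iInter (fun s => (measurableSet_level T s).nullMeasurableSet)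
    ⟨0, measure_ne_top _ _⟩

/-- The levels decrease to the class, so a strict upper bound on its measure is already visible at a
finite level as an inequality between natural numbers. Small measure is thus a `Σ⁰₁` event. -/
theorem measure_treeClass_lt_iff (T : List Bool → Prop) (k : ℕ) :
    measure (treeClass T) < (2 ^ k)⁻¹ ↔ ∃ s, count (Good T) s * 2 ^ k < 2 ^ s := by
  rw [measure_treeClass, iInf_lt_iff]
  exact exists_congr fun s => by rw [measure_level, natCast_mul_inv_two_pow_lt]

theorem count_eq_zero_iff {p : List Bool → Prop} {s : ℕ} :
    count p s = 0 ↔ {X : Space | p (restrict X s)} = ∅ := by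
  classical
  rw [count, List.length_eq_zero_iff, List.filter_eq_nil_iff]
  constructor
  · intro h
    ext X
    simpa using h (restrict X s) (mem_strings.2 (by simp))
  · intro h v hv hp
    obtain ⟨X, hX⟩ := basicOpen_nonempty v
    have : X ∈ {X : Space | p (restrict X s)} := by
      rw [Set.mem_ofPred_eq, ← mem_strings.1 hv, mem_basicOpen.1 hX]
      simpa using hp
    simp [h] at this

/-- By compactness emptiness appears at a finite level, so it too is a `Σ⁰₁` event. -/
theorem treeClass_eq_empty_iff (T : List Bool → Prop) :
    treeClass T = ∅ ↔ ∃ s, count (Good T) s = 0 := by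
  constructor
  · intro h
    by_contra! hne
    have h1 : ∀ s, (level T s).Nonempty := fun s => by
      rw [Set.nonempty_iff_ne_empty, level_eq]
      exact fun h => hne s (count_eq_zero_iff.2 h)
    have h2 := IsCompact.nonempty_iInter_of_sequence_nonempty_isCompact_isClosed (level T)
      (fun s => level_anti T s.le_succ) h1 (isClosed_level T 0).isCompact (isClosed_level T)
    rw [iInter_level, h] at h2
    exact Set.not_nonempty_empty h2
  · rintro ⟨s, hs⟩
    rw [count_eq_zero_iff, ← level_eq] at hs
    exact Set.subset_empty_iff.1 (hs ▸ treeClass_subset_level T s)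

/-- The part of `T` compatible with `τ`. -/
def restrTree (T : List Bool → Prop) (τ v : List Bool) : Prop :=
  T v ∧ v.take τ.length = τ.take v.length

theorem forall_take_restrict_iff {X : Space} {τ : List Bool} :
    (∀ n, (restrict X n).take τ.length = τ.take (restrict X n).length) ↔ X ∈ basicOpen τ := by
  rw [mem_basicOpen]
  constructor
  · intro h
    simpa [List.take_of_length_le] using h τ.length
  · intro h n
    rw [length_restrict]
    rcases le_total n τ.length with hn | hn
    · rw [List.take_of_length_le (by simpa using hn)]
      conv_rhs => rw [← h]
      rw [take_restrict X hn]
    · rw [take_restrict X hn, h, List.take_of_length_le hn]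

theorem treeClass_restrTree (T : List Bool → Prop) (τ : List Bool) :
    treeClass (restrTree T τ) = treeClass T ∩ basicOpen τ := by
  ext X
  simp only [treeClass, restrTree, Set.mem_ofPred_eq, Set.mem_inter_iff, forall_and,
    forall_take_restrict_iff]

section Primrec

variable {α : Type*} [Primcodable α]

theorem primrec_count_strings {p : α → List Bool → Prop}
    (hp : PrimrecPred fun q : α × List Bool => p q.1 q.2) :
    Primrec₂ fun a s => count (p a) s := by
  have h : PrimrecPred fun q : (α × ℕ) × List Bool => p q.1.1 q.2 :=
    hp.comp ((Primrec.fst.comp Primrec.fst).pair Primrec.snd)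
  exact primrec_count h (primrec_strings.comp Primrec.snd)

theorem primrecPred_good {T : α → List Bool → Prop}
    (hT : PrimrecPred fun q : α × List Bool => T q.1 q.2) :
    PrimrecPred fun q : α × List Bool => Good (T q.1) q.2 := by
  refine primrecPred_forall_le (p := fun q i => T q.1 (q.2.take i)) ?_
    (Primrec.list_length.comp Primrec.snd)
  exact hT.comp ((Primrec.fst.comp Primrec.fst).pair
    (Primrec.list_take.comp Primrec.snd (Primrec.snd.comp Primrec.fst)))

theorem primrec_count_good {T : α → List Bool → Prop}
    (hT : PrimrecPred fun q : α × List Bool => T q.1 q.2) :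
    Primrec₂ fun a s => count (Good (T a)) s :=
  primrec_count_strings (primrecPred_good hT)

theorem primrecPred_restrTree {T : α → List Bool → Prop}
    (hT : PrimrecPred fun q : α × List Bool => T q.1 q.2) :
    PrimrecPred fun q : (α × List Bool) × List Bool => restrTree (T q.1.1) q.1.2 q.2 := by
  refine PrimrecPred.and (hT.comp ((Primrec.fst.comp Primrec.fst).pair Primrec.snd)) ?_
  exact Primrec.eq.comp
    (Primrec.list_take.comp (Primrec.list_length.comp (Primrec.snd.comp Primrec.fst)) Primrec.snd)
    (Primrec.list_take.comp (Primrec.list_length.comp Primrec.snd) (Primrec.snd.comp Primrec.fst))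

end Primrec

/-! ### Enumerating `Π⁰₁` classes by codes -/

open Nat.Partrec (Code)

/-- The computation of the `c`-th code on input `n` halts within `k` steps. -/
def Halts (c k n : ℕ) : Prop := (Code.evaln k (Denumerable.ofNat Code c) n).isSome = true

theorem Halts.mono {c k k' n : ℕ} (h : Halts c k n) (hk : k ≤ k') : Halts c k' n := by
  obtain ⟨x, hx⟩ := Option.isSome_iff_exists.1 h
  exact Option.isSome_iff_exists.2 ⟨x, Code.evaln_mono hk hx⟩

theorem primrecPred_halts : PrimrecPred fun q : ℕ × ℕ × ℕ => Halts q.1 q.2.1 q.2.2 := by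
  have h : Primrec fun q : ℕ × ℕ × ℕ =>
      (Code.evaln q.2.1 (Denumerable.ofNat Code q.1) q.2.2).isSome :=
    Primrec.option_isSome.comp (Code.primrec_evaln.comp
      (((Primrec.fst.comp Primrec.snd).pair ((Primrec.ofNat Code).comp Primrec.fst)).pair
        (Primrec.snd.comp Primrec.snd)))
  exact Primrec.eq.comp h (Primrec.const true)

theorem exists_halts_of_rePred {α : Type*} [Primcodable α] {p : α → Prop} (hp : REPred p) :
    ∃ c, ∀ a, p a ↔ ∃ k, Halts c k (Encodable.encode a) := by
  obtain ⟨c, hc⟩ := Code.exists_code.1 hp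
  refine ⟨Encodable.encode c, fun a => ?_⟩
  have h : p a ↔ (c.eval (Encodable.encode a)).Dom := by
    rw [hc]
    simp [Part.assert]
  rw [h, Part.dom_iff_mem]
  simp only [Code.evaln_complete, Halts, Denumerable.ofNat_encode, Option.isSome_iff_exists]
  exact exists_comm

theorem isPi01Class_treeClass {T : List Bool → Prop} (hT : PrimrecPred T) :
    IsPi01Class (treeClass T) := by
  refine ⟨{σ | ¬ T σ}, hT.not.computablePred.to_re, ?_⟩
  ext X
  simp only [treeClass, openSet, Set.mem_ofPred_eq, Set.mem_compl_iff, Set.mem_iUnion, exists_prop,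
    not_exists, not_and]
  constructor
  · intro h σ hσ hX
    rw [← mem_basicOpen.1 hX] at hσ
    exact hσ (h _)
  · intro h n
    by_contra hn
    exact h _ hn (mem_basicOpen_restrict X n)

/-- A tree for the complement of the open set enumerated by the `c`-th code. -/
def enumTree (c : ℕ) (v : List Bool) : Prop :=
  ∀ i ≤ v.length, ¬ Halts c v.length (Encodable.encode (v.take i))

theorem primrecPred_enumTree : PrimrecPred fun q : ℕ × List Bool => enumTree q.1 q.2 := by
  refine primrecPred_forall_le
    (p := fun (q : ℕ × List Bool) i => ¬ Halts q.1 q.2.length (Encodable.encode (q.2.take i))) ?_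
    (Primrec.list_length.comp Primrec.snd)
  refine PrimrecPred.not (primrecPred_halts.comp ((Primrec.fst.comp Primrec.fst).pair
    ((Primrec.list_length.comp (Primrec.snd.comp Primrec.fst)).pair ?_)))
  exact Primrec.encode.comp (Primrec.list_take.comp Primrec.snd (Primrec.snd.comp Primrec.fst))

theorem IsPi01Class.exists_enumTree {S : Set Space} (hS : IsPi01Class S) :
    ∃ c, S = treeClass (enumTree c) := by
  obtain ⟨W, hW, rfl⟩ := hS
  obtain ⟨c, hc⟩ := exists_halts_of_rePred hW
  refine ⟨c, ?_⟩
  ext X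
  simp only [treeClass, openSet, Set.mem_ofPred_eq, Set.mem_compl_iff, Set.mem_iUnion, exists_prop,
    not_exists, not_and, enumTree, length_restrict]
  constructor
  · intro h n i hi hH
    rw [take_restrict X hi] at hH
    exact h _ ((hc _).2 ⟨n, hH⟩) (mem_basicOpen_restrict X i)
  · intro h σ hσ hX
    obtain ⟨k, hk⟩ := (hc σ).1 hσ
    refine h (max σ.length k) σ.length (le_max_left _ _) ?_
    rw [take_restrict X (le_max_left _ _), mem_basicOpen.1 hX]
    exact hk.mono (le_max_right _ _)

/-! ### Random points and the measure of `Π⁰₁` classes -/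

/-- A null `Π⁰₁` class is covered by a Martin-Löf test: for the `n`-th member, wait for a level of
measure below `2^-n`. -/
theorem measure_treeClass_ne_zero {T : List Bool → Prop} (hT : PrimrecPred T) {X : Space}
    (hX : IsMLRandom X) (hXT : X ∈ treeClass T) : measure (treeClass T) ≠ 0 := by
  intro h0
  let W : ℕ → Set (List Bool) := fun n =>
    {σ | count (Good T) σ.length * 2 ^ n < 2 ^ σ.length ∧ Good T σ}
  have hgood : PrimrecPred (Good T) := by
    have h := primrecPred_good (α := Unit) (T := fun _ => T) (hT.comp Primrec.snd)
    exact h.comp ((Primrec.const ()).pair Primrec.id)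
  have hcount : Primrec fun s => count (Good T) s := by
    have h := primrec_count_good (α := Unit) (T := fun _ => T) (hT.comp Primrec.snd)
    exact h.comp (Primrec.const ()) Primrec.id
  have hlen : Primrec fun q : ℕ × List Bool => q.2.length := Primrec.list_length.comp Primrec.snd
  refine hX (fun n => openSet (W n)) ⟨⟨W, ?_, fun n => rfl⟩, fun n => ?_⟩ ?_
  · refine PrimrecPred.computablePred (PrimrecPred.and ?_ (hgood.comp Primrec.snd)) |>.to_re
    exact Primrec.nat_lt.comp (Primrec.nat_mul.comp (hcount.comp hlen)
      (primrec_two_pow Primrec.fst)) (primrec_two_pow hlen)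
  · by_cases hex : ∃ s, count (Good T) s * 2 ^ n < 2 ^ s
    · classical
      -- Later levels are contained in the first one that is small enough, so that one bounds the
      -- whole union.
      have hsub : openSet (W n) ⊆ level T (Nat.find hex) := by
        intro Y hY
        simp only [openSet, Set.mem_iUnion, exists_prop] at hY
        obtain ⟨σ, ⟨hσ, hgσ⟩, hYσ⟩ := hY
        refine level_anti T (Nat.find_min' hex hσ) ?_
        rw [level_eq, Set.mem_ofPred_eq, mem_basicOpen.1 hYσ]
        exact hgσ
      refine (measure_mono hsub).trans (le_of_lt ?_)
      rw [measure_level, ← ENNReal.inv_pow, natCast_mul_inv_two_pow_lt]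
      exact Nat.find_spec hex
    · have : openSet (W n) = ∅ := by
        push Not at hex
        ext Y
        simp only [openSet, Set.mem_iUnion, exists_prop, Set.mem_empty_iff_false, iff_false]
        rintro ⟨σ, ⟨hσ, _⟩, _⟩
        exact absurd hσ (not_lt.2 (hex _))
      simp [this]
  · rw [Set.mem_iInter]
    intro n
    obtain ⟨s, hs⟩ := (measure_treeClass_lt_iff T n).1 (by
      rw [h0]
      simp)
    simp only [openSet, Set.mem_iUnion, exists_prop]
    refine ⟨restrict X s, ⟨by simpa using hs, ?_⟩, mem_basicOpen_restrict X s⟩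
    have := treeClass_subset_level T s hXT
    rwa [level_eq] at this

/-- An elementary substitute for the Lebesgue density theorem: summing the local bound over the
strings of a level and letting the level shrink to the class gives `μ ≤ ε μ` with `ε < 1`. -/
theorem measure_treeClass_eq_zero {T : List Bool → Prop} {ε : ℝ≥0∞} (hε : ε < 1) (n : ℕ)
    (h : ∀ τ : List Bool, n ≤ τ.length →
      measure (treeClass T ∩ basicOpen τ) ≤ ε * measure (basicOpen τ)) :
    measure (treeClass T) = 0 := by
  have h1 : ∀ s, n ≤ s → measure (treeClass T) ≤ ε * measure (level T s) := by
    intro s hs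
    have hfin := finite_setOf_length (Good T) s
    have hlev : level T s = ⋃ v ∈ hfin.toFinset, basicOpen v := by
      rw [level_eq, setOf_restrict_eq_biUnion]
      simp
    calc measure (treeClass T)
        ≤ measure (⋃ v ∈ hfin.toFinset, treeClass T ∩ basicOpen v) := by
          refine measure_mono fun X hX => ?_
          have hX' := treeClass_subset_level T s hX
          rw [hlev] at hX'
          simp only [Set.mem_iUnion] at hX' ⊢
          obtain ⟨v, hv, hXv⟩ := hX'
          exact ⟨v, hv, hX, hXv⟩
      _ ≤ ∑ v ∈ hfin.toFinset, measure (treeClass T ∩ basicOpen v) := measure_biUnion_finset_le _ _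
      _ ≤ ∑ v ∈ hfin.toFinset, ε * measure (basicOpen v) := by
          refine Finset.sum_le_sum fun v hv => h v ?_
          rw [(hfin.mem_toFinset.1 hv).1]
          exact hs
      _ = ε * measure (level T s) := by
          rw [← Finset.mul_sum, hlev, measure_biUnion_finset]
          · intro v hv w hw hne
            exact disjoint_basicOpen_of_length
              ((hfin.mem_toFinset.1 hv).1.trans (hfin.mem_toFinset.1 hw).1.symm) hne
          · exact fun v _ => measurableSet_basicOpen v
  have h2 : measure (treeClass T) ≤ ε * measure (treeClass T) := by
    conv_rhs => rw [measure_treeClass]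
    rw [ENNReal.mul_iInf' (fun h => absurd h (ne_top_of_lt hε)) fun _ => ⟨0⟩]
    refine le_iInf fun s => ?_
    exact (h1 (max n s) (le_max_left _ _)).trans
      (mul_le_mul_right (measure_mono (level_anti T (le_max_right _ _))) _)
  by_contra h0
  have h3 : ε * measure (treeClass T) < 1 * measure (treeClass T) :=
    ENNReal.mul_lt_mul_left h0 (measure_ne_top _ _) hε
  rw [one_mul] at h3
  exact absurd h2 (not_le.2 h3)

/-- A point of a `Π⁰₁` class at which some extension has large relative measure. -/
theorem exists_large_extension {T : List Bool → Prop} (hT : PrimrecPred T) {X : Space}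
    (hX : IsMLRandom X) (hXT : X ∈ treeClass T) {ε : ℝ≥0∞} (hε : ε < 1) (ρ : List Bool)
    (hρ : X ∈ basicOpen ρ) :
    ∃ τ, ρ <+: τ ∧ ε * measure (basicOpen τ) < measure (treeClass T ∩ basicOpen τ) := by
  have hT' : PrimrecPred (restrTree T ρ) := by
    have h := primrecPred_restrTree (α := Unit) (T := fun _ => T) (hT.comp Primrec.snd)
    exact h.comp (((Primrec.const ()).pair (Primrec.const ρ)).pair Primrec.id)
  have h0 := measure_treeClass_ne_zero hT' hX (by rw [treeClass_restrTree]; exact ⟨hXT, hρ⟩)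
  by_contra! hcon
  refine h0 (measure_treeClass_eq_zero hε ρ.length fun τ hτ => ?_)
  rw [treeClass_restrTree]
  by_cases hp : ρ <+: τ
  · exact (measure_mono (Set.inter_subset_inter_left _ Set.inter_subset_left)).trans (hcon τ hp)
  · have : treeClass T ∩ basicOpen ρ ∩ basicOpen τ = ∅ := by
      ext Y
      simp only [Set.mem_inter_iff, Set.mem_empty_iff_false, iff_false, not_and]
      exact fun hY hY' => hp (prefix_of_mem_basicOpen hY.2 hY' hτ)
    simp [this]

/-- No block of three ones starts at or after position `n`. -/
def noBlockTree (n : ℕ) (v : List Bool) : Prop :=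
  n + 3 ≤ v.length → v.drop (v.length - 3) ≠ [true, true, true]

theorem primrecPred_noBlockTree (n : ℕ) : PrimrecPred (noBlockTree n) := by
  refine primrecPred_imp (Primrec.nat_le.comp (Primrec.const _) Primrec.list_length) ?_
  refine PrimrecPred.not (Primrec.eq.comp ?_ (Primrec.const _))
  exact Primrec.list_drop.comp (Primrec.nat_sub.comp Primrec.list_length (Primrec.const 3))
    Primrec.id

/-- Avoiding `111` from position `n` on costs an eighth of the measure above every string of length
at least `n`, so the sequences that do so form a null `Π⁰₁` class. -/
theorem IsMLRandom.exists_block {X : Space} (hX : IsMLRandom X) (n : ℕ) :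
    ∃ m, n ≤ m ∧ X ∈ basicOpen (restrict X m ++ [true, true, true]) := by
  by_contra! hcon
  have hmem : X ∈ treeClass (noBlockTree n) := by
    intro s hs heq
    rw [length_restrict] at hs heq
    refine hcon (s - 3) (by omega) ?_
    rw [← heq, ← take_restrict X (Nat.sub_le s 3), List.take_append_drop]
    exact mem_basicOpen_restrict X s
  have hsub : ∀ τ : List Bool, n ≤ τ.length →
      treeClass (noBlockTree n) ∩ basicOpen τ ⊆
        basicOpen τ \ basicOpen (τ ++ [true, true, true]) := by
    rintro τ hτ Y ⟨hY, hYτ⟩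
    refine ⟨hYτ, fun hY' => ?_⟩
    have h1 := hY (τ.length + 3)
    rw [mem_basicOpen, List.length_append] at hY'
    simp only [List.length_cons, List.length_nil] at hY'
    rw [hY'] at h1
    exact h1 (by simpa using hτ) (by simp)
  refine measure_treeClass_ne_zero (primrecPred_noBlockTree n) hX hmem
    (measure_treeClass_eq_zero (ε := 1 - (2 ^ 3)⁻¹) ?_ n fun τ hτ => ?_)
  · exact ENNReal.sub_lt_self (by simp) (by simp) (by simp)
  · refine (measure_mono (hsub τ hτ)).trans (le_of_eq ?_)
    rw [measure_sdiff (basicOpen_anti (List.prefix_append _ _))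
      (measurableSet_basicOpen _).nullMeasurableSet (measure_ne_top _ _),
      ENNReal.sub_mul (fun _ _ => measure_ne_top _ _), one_mul, measure_basicOpen,
      measure_basicOpen, List.length_append]
    simp only [List.length_cons, List.length_nil]
    congr 1
    rw [← ENNReal.mul_inv (by simp) (by simp), ← pow_add, add_comm]

/-! ### A universal Martin-Löf test -/

/-- Some initial segment of the string is enumerated into the member of index `k + 3` of the
`k`-th candidate for a Martin-Löf test. -/
def Hit (k : ℕ) (v : List Bool) : Prop :=
  ∃ i ≤ v.length, Halts k v.length (Encodable.encode (k + 3, v.take i))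

theorem primrecPred_hit : PrimrecPred fun q : ℕ × List Bool => Hit q.1 q.2 := by
  refine primrecPred_exists_le (p := fun (q : ℕ × List Bool) i =>
    Halts q.1 q.2.length (Encodable.encode (q.1 + 3, q.2.take i))) ?_
    (Primrec.list_length.comp Primrec.snd)
  refine primrecPred_halts.comp ((Primrec.fst.comp Primrec.fst).pair
    ((Primrec.list_length.comp (Primrec.snd.comp Primrec.fst)).pair ?_))
  exact Primrec.encode.comp ((Primrec.nat_add.comp (Primrec.fst.comp Primrec.fst)
    (Primrec.const 3)).pair
    (Primrec.list_take.comp Primrec.snd (Primrec.snd.comp Primrec.fst)))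

theorem Hit.mono {k : ℕ} {X : Space} {s t : ℕ} (h : Hit k (restrict X s)) (hst : s ≤ t) :
    Hit k (restrict X t) := by
  obtain ⟨i, hi, hH⟩ := h
  rw [length_restrict] at hi hH
  refine ⟨i, by simpa using hi.trans hst, ?_⟩
  rw [length_restrict, take_restrict X (hi.trans hst)]
  rw [take_restrict X hi] at hH
  exact hH.mono hst

/-- A tree whose paths avoid a universal Martin-Löf test. -/
def randTree (v : List Bool) : Prop :=
  ∀ k ≤ v.length, count (Hit k) v.length * 2 ^ (k + 2) < 2 ^ v.length → ¬ Hit k v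

theorem primrecPred_randTree : PrimrecPred randTree := by
  refine primrecPred_forall_le (p := fun (v : List Bool) k =>
    count (Hit k) v.length * 2 ^ (k + 2) < 2 ^ v.length → ¬ Hit k v) ?_ Primrec.list_length
  have hlen : Primrec fun q : List Bool × ℕ => q.1.length := Primrec.list_length.comp Primrec.fst
  refine primrecPred_imp (Primrec.nat_lt.comp (Primrec.nat_mul.comp ?_ ?_) ?_)
    (primrecPred_hit.comp (Primrec.snd.pair Primrec.fst)).not
  · exact (primrec_count_strings primrecPred_hit).comp Primrec.snd hlen
  · exact primrec_two_pow (Primrec.nat_add.comp Primrec.snd (Primrec.const 2))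
  · exact primrec_two_pow hlen

/-- A genuine test is the `k`-th candidate for some `k`. Its member of index `k + 3` has measure at
most `2^-(k+3)`, strictly below the threshold `2^-(k+2)` in `randTree`, so the guard never protects
its points. -/
theorem isMLRandom_of_mem_randTree {X : Space} (hX : X ∈ treeClass randTree) : IsMLRandom X := by
  rintro U ⟨⟨W, hW, hU⟩, hm⟩ hXU
  obtain ⟨k, hk⟩ := exists_halts_of_rePred hW
  have hXk := Set.mem_iInter.1 hXU (k + 3)
  rw [hU] at hXk
  simp only [openSet, Set.mem_iUnion, exists_prop] at hXk
  obtain ⟨σ, hσ, hXσ⟩ := hXk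
  obtain ⟨j, hj⟩ := (hk (k + 3, σ)).1 hσ
  -- At this height `σ` is an initial segment, its enumeration has halted, and `randTree` is
  -- checking candidate `k`.
  set s := max (max σ.length j) k
  have hσs : σ.length ≤ s := (le_max_left _ _).trans (le_max_left _ _)
  refine hX s k (by simp [s]) ?_ ⟨σ.length, by simpa using hσs, ?_⟩
  · rw [length_restrict, ← natCast_mul_inv_two_pow_lt, ← measure_setOf_restrict]
    have hsub : {Y : Space | Hit k (restrict Y s)} ⊆ U (k + 3) := by
      rintro Y ⟨i, hi, hH⟩
      rw [hU]
      simp only [openSet, Set.mem_iUnion, exists_prop]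
      exact ⟨(restrict Y s).take i, (hk (k + 3, _)).2 ⟨_, hH⟩,
        basicOpen_anti (List.take_prefix _ _) (mem_basicOpen_restrict Y s)⟩
    refine ((measure_mono hsub).trans (hm _)).trans_lt ?_
    rw [← ENNReal.inv_pow, ENNReal.inv_lt_inv]
    exact_mod_cast Nat.pow_lt_pow_right (by norm_num : 1 < 2) (by omega : k + 2 < k + 3)
  · rw [length_restrict, take_restrict X hσs, mem_basicOpen.1 hXσ]
    exact hj.mono ((le_max_right _ _).trans (le_max_left _ _))

/-- The guard lets candidate `k` remove measure at most `2^-(k+2)`, even if it is not a test; the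
total removed is at most `1/2`. -/
theorem treeClass_randTree_nonempty : (treeClass randTree).Nonempty := by
  rw [Set.nonempty_iff_ne_empty]
  intro hempty
  let B : ℕ → ℕ → Set Space := fun k s =>
    {X | count (Hit k) s * 2 ^ (k + 2) < 2 ^ s ∧ Hit k (restrict X s)}
  have hB : ∀ k, measure (⋃ s, B k s) ≤ (2 ^ (k + 2))⁻¹ := by
    intro k
    -- `Hit` is monotone in the height, while a stage at which the guard fails contributes the empty
    -- set.
    have hdir : Directed (· ⊆ ·) (B k) := by
      intro s t
      by_cases hs : count (Hit k) s * 2 ^ (k + 2) < 2 ^ s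
      · by_cases ht : count (Hit k) t * 2 ^ (k + 2) < 2 ^ t
        · rcases le_total s t with h | h
          · exact ⟨t, fun X hX => ⟨ht, hX.2.mono h⟩, subset_rfl⟩
          · exact ⟨s, subset_rfl, fun X hX => ⟨hs, hX.2.mono h⟩⟩
        · exact ⟨s, subset_rfl, fun X hX => absurd hX.1 ht⟩
      · exact ⟨t, fun X hX => absurd hX.1 hs, subset_rfl⟩
    rw [hdir.measure_iUnion]
    refine iSup_le fun s => ?_
    by_cases hs : count (Hit k) s * 2 ^ (k + 2) < 2 ^ s
    · refine (measure_mono (t := {X : Space | Hit k (restrict X s)}) fun X hX => hX.2).trans ?_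
      rw [measure_setOf_restrict]
      exact (natCast_mul_inv_two_pow_lt.2 hs).le
    · have : B k s = ∅ := Set.eq_empty_of_forall_notMem fun X hX => hs hX.1
      simp [this]
  have hcov : (Set.univ : Set Space) ⊆ ⋃ k, ⋃ s, B k s := by
    intro X _
    by_contra hX
    simp only [Set.mem_iUnion, not_exists] at hX
    have : X ∈ treeClass randTree := by
      intro s k _ hc hH
      rw [length_restrict] at hc
      exact hX k s ⟨hc, hH⟩
    simp [hempty] at this
  have h1 : (1 : ℝ≥0∞) ≤ 2⁻¹ := calc
    (1 : ℝ≥0∞) = measure Set.univ := measure_univ.symm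
    _ ≤ measure (⋃ k, ⋃ s, B k s) := measure_mono hcov
    _ ≤ ∑' k, measure (⋃ s, B k s) := measure_iUnion_le _
    _ ≤ ∑' k : ℕ, ((2 : ℝ≥0∞)⁻¹) ^ (k + 2) := by
        refine ENNReal.tsum_le_tsum fun k => ?_
        rw [← ENNReal.inv_pow]
        exact hB k
    _ = 2⁻¹ := by
        rw [tsum_congr fun k : ℕ => pow_add (2 : ℝ≥0∞)⁻¹ k 2, ENNReal.tsum_mul_right,
          ENNReal.tsum_geometric, ENNReal.one_sub_inv_two, inv_inv, pow_two, ← mul_assoc,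
          ENNReal.mul_inv_cancel (by simp) (by simp), one_mul]
  simp at h1

/-! ### Forcing conditions -/

/-- An enumeration of the `Π⁰₁` classes in which every class occurs infinitely often. -/
def piTree (e : ℕ) : List Bool → Prop := enumTree e.unpair.1

theorem primrecPred_piTree : PrimrecPred fun q : ℕ × List Bool => piTree q.1 q.2 :=
  primrecPred_enumTree.comp ((Primrec.fst.comp (Primrec.unpair.comp Primrec.fst)).pair Primrec.snd)

/-- The paths through `randTree` that extend `σ` and along which, above `σ`, the `e`-th class has
relative measure at least `2⁻⁽ᵉ⁺³⁾` for every `e` switched on by `a`. -/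
def condClass (σ a : List Bool) : Set Space :=
  {X | X ∈ treeClass randTree ∩ basicOpen σ ∧ ∀ e, a[e]? = some true → ∀ m, σ.length ≤ m →
    (2 ^ (e + 3))⁻¹ * measure (basicOpen (restrict X m)) ≤
      measure (treeClass (piTree e) ∩ basicOpen (restrict X m))}

/-- A tree for `condClass σ a`. -/
def condTree (σ a v : List Bool) : Prop :=
  restrTree randTree σ v ∧ ∀ e < a.length, a[e]? = some true → ∀ m ≤ v.length, σ.length ≤ m →
    ¬ count (Good (restrTree (piTree e) (v.take m))) v.length * 2 ^ (e + 3 + m) < 2 ^ v.length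

theorem inv_two_pow_mul_measure_basicOpen (k : ℕ) (τ : List Bool) :
    (2 ^ k)⁻¹ * measure (basicOpen τ) = (2 ^ (k + τ.length))⁻¹ := by
  rw [measure_basicOpen, pow_add, ENNReal.mul_inv (by simp) (by simp)]

theorem measure_inter_lt_iff (T : List Bool → Prop) (τ : List Bool) (k : ℕ) :
    measure (treeClass T ∩ basicOpen τ) < (2 ^ k)⁻¹ * measure (basicOpen τ) ↔
      ∃ s, count (Good (restrTree T τ)) s * 2 ^ (k + τ.length) < 2 ^ s := by
  rw [inv_two_pow_mul_measure_basicOpen, ← treeClass_restrTree, measure_treeClass_lt_iff]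

theorem count_good_lt_mono (T : List Bool → Prop) {k s t : ℕ} (hst : s ≤ t)
    (h : count (Good T) s * 2 ^ k < 2 ^ s) : count (Good T) t * 2 ^ k < 2 ^ t := by
  rw [← natCast_mul_inv_two_pow_lt, ← measure_level] at *
  exact (measure_mono (level_anti T hst)).trans_lt h

theorem treeClass_condTree (σ a : List Bool) : treeClass (condTree σ a) = condClass σ a := by
  ext X
  have h1 : X ∈ treeClass (condTree σ a) ↔ X ∈ treeClass (restrTree randTree σ) ∧
      ∀ n, ∀ e < a.length, a[e]? = some true → ∀ m ≤ n, σ.length ≤ m →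
        ¬ count (Good (restrTree (piTree e) (restrict X m))) n * 2 ^ (e + 3 + m) < 2 ^ n := by
    simp only [treeClass, Set.mem_ofPred_eq, condTree, length_restrict, forall_and]
    refine and_congr_right fun _ => forall_congr' fun n => forall₄_congr fun e _ _ m => ?_
    exact forall_congr' fun hm => by rw [take_restrict X hm]
  rw [h1, treeClass_restrTree]
  refine and_congr_right fun _ => ?_
  constructor
  · intro h e he m hm
    by_contra hlt
    rw [not_le, measure_inter_lt_iff, length_restrict] at hlt
    obtain ⟨s, hs⟩ := hlt
    have hea : e < a.length := by
      by_contra hcon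
      rw [List.getElem?_eq_none (not_lt.1 hcon)] at he
      simp at he
    -- The tree examines level `m` only at heights at least `m`; a small count persists to greater
    -- heights.
    exact h (max m s) e hea he m (le_max_left _ _) hm (count_good_lt_mono _ (le_max_right _ _) hs)
  · intro h n e _ he m _ hm hlt
    have h2 := h e he m hm
    rw [← not_lt, measure_inter_lt_iff, length_restrict] at h2
    exact h2 ⟨n, hlt⟩

theorem primrecPred_count_lt {α β : Type*} [Primcodable α] [Primcodable β]
    {T : β → List Bool → Prop} (hT : PrimrecPred fun q : β × List Bool => T q.1 q.2)
    {f : α → β} (hf : Primrec f) {g : α → List Bool} (hg : Primrec g) {h k : α → ℕ}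
    (hh : Primrec h) (hk : Primrec k) :
    PrimrecPred fun x =>
      count (Good (restrTree (T (f x)) (g x))) (h x) * 2 ^ k x < 2 ^ h x := by
  have h1 : Primrec fun x => count (Good (restrTree (T (f x)) (g x))) (h x) :=
    (primrec_count_good (T := fun q : β × List Bool => restrTree (T q.1) q.2)
      (primrecPred_restrTree hT)).comp (hf.pair hg) hh
  exact Primrec.nat_lt.comp (Primrec.nat_mul.comp h1 (primrec_two_pow hk)) (primrec_two_pow hh)

theorem primrecPred_condTree :
    PrimrecPred fun q : (List Bool × List Bool) × List Bool => condTree q.1.1 q.1.2 q.2 := by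
  have hlen {α : Type} [Primcodable α] {f : α → List Bool} (hf : Primrec f) :
      Primrec fun x => (f x).length := Primrec.list_length.comp hf
  refine PrimrecPred.and ?_ (primrecPred_forall_lt
    (p := fun (q : (List Bool × List Bool) × List Bool) e =>
      q.1.2[e]? = some true → ∀ m ≤ q.2.length, q.1.1.length ≤ m →
        ¬ count (Good (restrTree (piTree e) (q.2.take m))) q.2.length * 2 ^ (e + 3 + m) <
          2 ^ q.2.length) ?_ (hlen (Primrec.snd.comp Primrec.fst)))
  · exact (primrecPred_restrTree (α := Unit) (T := fun _ => randTree)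
      (primrecPred_randTree.comp Primrec.snd)).comp
      (((Primrec.const ()).pair (Primrec.fst.comp Primrec.fst)).pair Primrec.snd)
  · refine primrecPred_imp (Primrec.eq.comp (Primrec.list_getElem?.comp
      (Primrec.snd.comp (Primrec.fst.comp Primrec.fst)) Primrec.snd) (Primrec.const _)) ?_
    refine primrecPred_forall_le (p := fun (q : ((List Bool × List Bool) × List Bool) × ℕ) m =>
      q.1.1.1.length ≤ m →
        ¬ count (Good (restrTree (piTree q.2) (q.1.2.take m))) q.1.2.length * 2 ^ (q.2 + 3 + m) <
          2 ^ q.1.2.length) ?_ (hlen (Primrec.snd.comp Primrec.fst))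
    have hv : Primrec fun r : (((List Bool × List Bool) × List Bool) × ℕ) × ℕ => r.1.1.2 :=
      Primrec.snd.comp (Primrec.fst.comp Primrec.fst)
    have he : Primrec fun r : (((List Bool × List Bool) × List Bool) × ℕ) × ℕ => r.1.2 :=
      Primrec.snd.comp Primrec.fst
    refine primrecPred_imp (Primrec.nat_le.comp
      (hlen (Primrec.fst.comp (Primrec.fst.comp (Primrec.fst.comp Primrec.fst)))) Primrec.snd) ?_
    exact PrimrecPred.not (primrecPred_count_lt primrecPred_piTree he
      (Primrec.list_take.comp Primrec.snd hv) (hlen hv)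
      (Primrec.nat_add.comp (Primrec.nat_add.comp he (Primrec.const 3)) Primrec.snd))

theorem primrecPred_condTree_apply (σ a : List Bool) : PrimrecPred (condTree σ a) :=
  primrecPred_condTree.comp (((Primrec.const σ).pair (Primrec.const a)).pair Primrec.id)

theorem isMLRandom_of_mem_condClass {σ a : List Bool} {X : Space} (hX : X ∈ condClass σ a) :
    IsMLRandom X :=
  isMLRandom_of_mem_randTree hX.1.1

/-! ### The measure lost to the on-requirements -/

/-- If every point of `E ⊆ [ρ]` has an initial segment above `ρ` at which `E` has relative measure
at most `ε`, then `E` has relative measure at most `ε` at `ρ`. -/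
theorem measure_le_of_cover {E : Set Space} {ρ : List Bool} {ε : ℝ≥0∞} (F : Set (List Bool))
    (hE : E ⊆ basicOpen ρ) (hcov : ∀ X ∈ E, ∃ m, ρ.length ≤ m ∧ restrict X m ∈ F)
    (hF : ∀ τ ∈ F, measure (E ∩ basicOpen τ) ≤ ε * measure (basicOpen τ)) :
    measure E ≤ ε * measure (basicOpen ρ) := by
  classical
  -- The members of `F` minimal above `ρ`: their cylinders are disjoint and still cover `E`.
  let G : Set (List Bool) :=
    {τ | τ ∈ F ∧ ρ <+: τ ∧ ∀ i, ρ.length ≤ i → i < τ.length → τ.take i ∉ F}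
  have hG : G.Countable := Set.to_countable G
  have hdis : G.PairwiseDisjoint basicOpen := by
    have aux : ∀ τ ∈ G, ∀ τ' ∈ G, ∀ X, X ∈ basicOpen τ → X ∈ basicOpen τ' →
        τ.length ≤ τ'.length → τ = τ' := by
      intro τ hτ τ' hτ' X hX hX' hle
      have hp := prefix_of_mem_basicOpen hX hX' hle
      rcases hle.lt_or_eq with hlt | heq
      · exact absurd (List.prefix_iff_eq_take.1 hp ▸ hτ.1) (hτ'.2.2 _ hτ.2.1.length_le hlt)
      · exact hp.eq_of_length heq
    intro τ hτ τ' hτ' hne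
    refine Set.disjoint_left.2 fun X hX hX' => hne ?_
    rcases le_total τ.length τ'.length with h | h
    · exact aux τ hτ τ' hτ' X hX hX' h
    · exact (aux τ' hτ' τ hτ X hX' hX h).symm
  have hsub : E ⊆ ⋃ τ ∈ G, E ∩ basicOpen τ := by
    intro X hX
    have hex := hcov X hX
    obtain ⟨h1, h2⟩ := Nat.find_spec hex
    simp only [Set.mem_iUnion, exists_prop]
    refine ⟨restrict X (Nat.find hex), ⟨h2, ?_, fun i hi hlt hF => ?_⟩, hX,
      mem_basicOpen_restrict _ _⟩
    · exact prefix_of_mem_basicOpen (hE hX) (mem_basicOpen_restrict _ _) (by simpa using h1)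
    · rw [length_restrict] at hlt
      rw [take_restrict X hlt.le] at hF
      exact Nat.find_min hex hlt ⟨hi, hF⟩
  calc measure E ≤ measure (⋃ τ ∈ G, E ∩ basicOpen τ) := measure_mono hsub
    _ ≤ ∑' τ : G, measure (E ∩ basicOpen τ) := measure_biUnion_le _ hG _
    _ ≤ ∑' τ : G, ε * measure (basicOpen τ) := ENNReal.tsum_le_tsum fun τ => hF τ τ.2.1
    _ = ε * measure (⋃ τ ∈ G, basicOpen τ) := by
        rw [ENNReal.tsum_mul_left,
          measure_biUnion hG hdis fun τ _ => measurableSet_basicOpen τ]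
    _ ≤ ε * measure (basicOpen ρ) := by
        refine mul_le_mul_right (measure_mono ?_) _
        exact Set.iUnion₂_subset fun τ hτ => basicOpen_anti hτ.2.1

theorem getElem?_append_singleton_eq_some {b : List Bool} {c d : Bool} {e : ℕ} :
    (b ++ [c])[e]? = some d ↔ b[e]? = some d ∨ e = b.length ∧ c = d := by
  rcases lt_trichotomy e b.length with h | rfl | h
  · simp [List.getElem?_append_left h, h.ne]
  · simp
  · rw [List.getElem?_eq_none (by simp; omega), List.getElem?_eq_none (by omega)]
    simp [h.ne']

theorem condClass_append_false (σ b : List Bool) : condClass σ (b ++ [false]) = condClass σ b := by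
  simp [condClass, getElem?_append_singleton_eq_some]

theorem mem_condClass_append_true {σ b : List Bool} {X : Space} :
    X ∈ condClass σ (b ++ [true]) ↔ X ∈ condClass σ b ∧ ∀ m, σ.length ≤ m →
      (2 ^ (b.length + 3))⁻¹ * measure (basicOpen (restrict X m)) ≤
        measure (treeClass (piTree b.length) ∩ basicOpen (restrict X m)) := by
  simp only [condClass, getElem?_append_singleton_eq_some, Set.mem_ofPred_eq, and_true, or_imp,
    forall_and, forall_eq, and_assoc]

theorem condClass_subset_of_prefix {σ τ b : List Bool} (h : σ <+: τ) :
    condClass σ b ∩ basicOpen τ ⊆ condClass τ b := fun _ hX =>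
  ⟨⟨hX.1.1.1, hX.2⟩, fun e he m hm => hX.1.2 e he m (h.length_le.trans hm)⟩

/-- A point lost by switching on the class passes through a string where the class is thin. By
`hsub` the lost points lie in the class, so they are thin there too, and `measure_le_of_cover`
applies. -/
theorem measure_condClass_le {σ ρ b : List Bool}
    (hsub : condClass σ b ⊆ treeClass (piTree b.length))
    (hne : (condClass σ (b ++ [true]) ∩ basicOpen ρ).Nonempty) :
    measure (condClass σ b ∩ basicOpen ρ) ≤ measure (condClass σ (b ++ [true]) ∩ basicOpen ρ) +
      (2 ^ (b.length + 3))⁻¹ * measure (basicOpen ρ) := by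
  set E := (condClass σ b \ condClass σ (b ++ [true])) ∩ basicOpen ρ
  have hE : measure E ≤ (2 ^ (b.length + 3))⁻¹ * measure (basicOpen ρ) := by
    refine measure_le_of_cover {τ | measure (treeClass (piTree b.length) ∩ basicOpen τ) <
      (2 ^ (b.length + 3))⁻¹ * measure (basicOpen τ)} Set.inter_subset_right ?_ ?_
    · rintro X ⟨⟨hX, hX'⟩, hXρ⟩
      rw [mem_condClass_append_true] at hX'
      simp only [hX, true_and, not_forall, not_le] at hX'
      obtain ⟨m, hm, hlt⟩ := hX'
      refine ⟨m, ?_, hlt⟩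
      by_contra hcon
      -- A surviving point through `ρ` shows that the class is not thin at any initial segment of
      -- `ρ` from `σ` on, so the thin string extends `ρ`.
      obtain ⟨Y, hY, hYρ⟩ := hne
      have hYX : restrict Y m = restrict X m := by
        rw [← take_restrict Y (not_le.1 hcon).le, ← take_restrict X (not_le.1 hcon).le,
          mem_basicOpen.1 hXρ, mem_basicOpen.1 hYρ]
      have := (mem_condClass_append_true.1 hY).2 m hm
      rw [hYX] at this
      exact absurd hlt (not_lt.2 this)
    · intro τ hτ
      exact (measure_mono (Set.inter_subset_inter_left _ fun X hX => hsub hX.1.1)).trans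
        (le_of_lt hτ)
  calc measure (condClass σ b ∩ basicOpen ρ)
      ≤ measure ((condClass σ (b ++ [true]) ∩ basicOpen ρ) ∪ E) := by
        refine measure_mono fun X hX => ?_
        by_cases h : X ∈ condClass σ (b ++ [true])
        · exact Or.inl ⟨h, hX.2⟩
        · exact Or.inr ⟨⟨hX.1, h⟩, hX.2⟩
    _ ≤ _ := (measure_union_le _ _).trans (add_le_add_right hE _)

/-- If every point of `condClass σ b` in `[τ]` violated the new requirement, thin strings above `τ`
would cover them all and contradict `hlt`. -/
theorem condClass_inter_nonempty {σ τ b : List Bool}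
    (hsub : condClass σ b ⊆ treeClass (piTree b.length)) (hστ : σ <+: τ)
    (hlt : (2 ^ (b.length + 3))⁻¹ * measure (basicOpen τ) < measure (condClass σ b ∩ basicOpen τ)) :
    (condClass σ b ∩ condClass τ (b ++ [true])).Nonempty := by
  by_contra hne
  rw [Set.not_nonempty_iff_eq_empty] at hne
  refine absurd hlt (not_lt.2 ?_)
  refine measure_le_of_cover {ρ | measure (treeClass (piTree b.length) ∩ basicOpen ρ) <
      (2 ^ (b.length + 3))⁻¹ * measure (basicOpen ρ)} Set.inter_subset_right ?_ ?_
  · intro X hX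
    have hX' : X ∉ condClass τ (b ++ [true]) := fun h => by
      have : X ∈ condClass σ b ∩ condClass τ (b ++ [true]) := ⟨hX.1, h⟩
      simp [hne] at this
    rw [mem_condClass_append_true] at hX'
    simp only [condClass_subset_of_prefix hστ hX, true_and, not_forall, not_le] at hX'
    obtain ⟨m, hm, h⟩ := hX'
    exact ⟨m, hm, h⟩
  · intro ρ hρ
    exact (measure_mono (Set.inter_subset_inter_left _ fun X hX => hsub hX.1)).trans (le_of_lt hρ)

/-- The requirements are imposed one at a time, and each on-class `e` costs at most `2^-(e+3)`.
Hence the smallness of `condClass` at `ρ` passes to `randTree`. -/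
theorem measure_randTree_le {σ a : List Bool}
    (hsub : ∀ e, a[e]? = some true → condClass σ (a.take e) ⊆ treeClass (piTree e))
    {ρ : List Bool} (hσρ : σ <+: ρ) (k : ℕ) (hk : k ≤ a.length)
    (hne : (condClass σ (a.take k) ∩ basicOpen ρ).Nonempty) :
    measure (treeClass randTree ∩ basicOpen ρ) ≤ measure (condClass σ (a.take k) ∩ basicOpen ρ) +
      (∑ e ∈ Finset.range k, (2 ^ (e + 3))⁻¹) * measure (basicOpen ρ) := by
  induction k with
  | zero =>
    refine le_add_right (measure_mono fun X hX => ⟨⟨⟨hX.1, basicOpen_anti hσρ hX.2⟩, ?_⟩, hX.2⟩)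
    simp
  | succ k ih =>
    have hk' : k < a.length := hk
    have hlen : (a.take k).length = k := by simp [hk'.le]
    have htake : a.take (k + 1) = a.take k ++ [a[k]] := by simp
    rw [htake] at hne ⊢
    rw [Finset.sum_range_succ, add_mul, add_comm (_ * _), ← add_assoc]
    have key : (condClass σ (a.take k) ∩ basicOpen ρ).Nonempty ∧
        measure (condClass σ (a.take k) ∩ basicOpen ρ) ≤
          measure (condClass σ (a.take k ++ [a[k]]) ∩ basicOpen ρ) +
            (2 ^ (k + 3))⁻¹ * measure (basicOpen ρ) := by
      cases hak : a[k] with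
      | false =>
        rw [hak, condClass_append_false] at hne
        rw [condClass_append_false]
        exact ⟨hne, le_add_right le_rfl⟩
      | true =>
        rw [hak] at hne
        refine ⟨hne.mono fun X hX => ⟨(mem_condClass_append_true.1 hX.1).1, hX.2⟩, ?_⟩
        have h := measure_condClass_le (σ := σ) (ρ := ρ) (b := a.take k) (by
          rw [hlen]
          exact hsub k (by rw [List.getElem?_eq_getElem hk', hak])) hne
        rwa [hlen] at h
    exact (ih hk'.le key.1).trans (add_le_add_left key.2 _)

theorem sum_inv_two_pow_le (k : ℕ) :
    ∑ e ∈ Finset.range k, ((2 : ℝ≥0∞) ^ (e + 3))⁻¹ ≤ (2 ^ 2)⁻¹ := by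
  have h : ∑ e ∈ Finset.range k, ((2 : ℝ≥0∞) ^ (e + 3))⁻¹ + (2 ^ (k + 2))⁻¹ = (2 ^ 2)⁻¹ := by
    induction k with
    | zero => simp
    | succ k ih =>
      rw [← ih, Finset.sum_range_succ, add_assoc, show k + 1 + 2 = k + 3 by omega, ← two_mul,
        pow_succ 2 (k + 2), ENNReal.mul_inv (by simp) (by simp), mul_comm, mul_assoc,
        ENNReal.inv_mul_cancel (by simp) (by simp), mul_one]
  exact h ▸ le_self_add

/-! ### Leftmost paths and sparse extensions -/

/-- A nonempty class of paths has a leftmost element. -/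
theorem exists_leftmost {T : List Bool → Prop} (hT : (treeClass T).Nonempty) :
    ∃ Z ∈ treeClass T, ∀ Y ∈ treeClass T, ∀ n, restrict Y n = restrict Z n → Z n = true →
      Y n = true := by
  classical
  let C (τ : List Bool) : Prop := (treeClass T ∩ basicOpen τ).Nonempty
  -- Greedy descent: take `false` whenever the class still meets that cylinder.
  let z : ℕ → List Bool := fun n =>
    Nat.rec [] (fun _ τ => τ ++ [!decide (C (τ ++ [false]))]) n
  let Z : Space := fun n => !decide (C (z n ++ [false]))
  have hz : ∀ n, restrict Z n = z n := by
    intro n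
    induction n with
    | zero => rfl
    | succ n ih => rw [restrict_succ, ih]
  have hC : ∀ n, C (z n) := by
    intro n
    induction n with
    | zero =>
      obtain ⟨X, hX⟩ := hT
      exact ⟨X, hX, rfl⟩
    | succ n ih =>
      change C (z n ++ [!decide (C (z n ++ [false]))])
      by_cases h : C (z n ++ [false])
      · simp [h]
      · obtain ⟨X, hX, hXn⟩ := ih
        have hl : (z n).length = n := by rw [← hz, length_restrict]
        have hXn' : restrict X n = z n := by simpa [mem_basicOpen, hl] using hXn
        have hb : ∀ b, X n = b → X ∈ basicOpen (z n ++ [b]) := by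
          rintro b rfl
          rw [← hXn', ← restrict_succ]
          exact mem_basicOpen_restrict X _
        cases hXb : X n with
        | false => exact absurd ⟨X, hX, hb _ hXb⟩ h
        | true =>
          simp only [h, decide_false, Bool.not_false]
          exact ⟨X, hX, hb _ hXb⟩
  refine ⟨Z, fun n => ?_, fun Y hY n hYZ hZ => ?_⟩
  · obtain ⟨X, hX, hXn⟩ := hC n
    have hl : (z n).length = n := by rw [← hz, length_restrict]
    rw [mem_basicOpen, hl] at hXn
    rw [hz, ← hXn]
    exact hX n
  · by_contra hYn
    rw [Bool.not_eq_true] at hYn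
    have h : ¬ C (z n ++ [false]) := by simpa [Z] using hZ
    refine h ⟨Y, hY, ?_⟩
    rw [← hz, ← hYZ, ← hYn, ← restrict_succ]
    exact mem_basicOpen_restrict Y _

/-- If the classes switched on cannot be avoided, then the next class can be switched on beyond a
string at which `randTree` has relative measure less than one half. -/
theorem exists_sparse_extension {σ a : List Bool} (hne : (condClass σ a).Nonempty)
    (hsub : ∀ e, a[e]? = some true → condClass σ (a.take e) ⊆ treeClass (piTree e))
    (hsub' : condClass σ a ⊆ treeClass (piTree a.length)) :
    ∃ ρ τ, σ <+: ρ ∧ σ.length < ρ.length ∧ ρ <+: τ ∧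
      measure (treeClass randTree ∩ basicOpen ρ) < (2 ^ 1)⁻¹ * measure (basicOpen ρ) ∧
      (condClass σ a ∩ condClass τ (a ++ [true])).Nonempty := by
  rw [← treeClass_condTree] at hne
  obtain ⟨Z, hZ, hleft⟩ := exists_leftmost hne
  rw [treeClass_condTree] at hZ hleft
  have hrand := isMLRandom_of_mem_condClass hZ
  -- The `+ 1` makes the sparse string, and hence the next condition, strictly longer than `σ`.
  obtain ⟨m, hm, hblock⟩ := hrand.exists_block (σ.length + 1)
  have hσρ : σ <+: restrict Z m :=
    prefix_of_mem_basicOpen hZ.1.2 (mem_basicOpen_restrict Z m) (by simp; omega)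
  have hZb : restrict Z (m + 3) = restrict Z m ++ [true, true, true] := by
    simpa [mem_basicOpen] using hblock
  -- A path agreeing with the leftmost one up to `m` cannot go left where `Z` goes right, so it
  -- repeats the three ones.
  have hsmall : condClass σ a ∩ basicOpen (restrict Z m) ⊆
      basicOpen (restrict Z m ++ [true, true, true]) := by
    rintro Y ⟨hY, hYρ⟩
    rw [mem_basicOpen, length_restrict] at hYρ
    have hZ' : ∀ X : Space, restrict X (m + 3) = restrict X m ++ [X m, X (m + 1), X (m + 2)] := by
      intro X
      simp [restrict_succ]
    rw [hZ'] at hZb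
    have hb := List.append_cancel_left hZb
    simp only [List.cons.injEq, and_true] at hb
    have h0 := hleft Y hY m hYρ hb.1
    have h1 := hleft Y hY (m + 1) (by rw [restrict_succ, restrict_succ, hYρ, h0, hb.1]) hb.2.1
    have h2 := hleft Y hY (m + 2) (by
      rw [restrict_succ, restrict_succ, restrict_succ, restrict_succ, hYρ, h0, hb.1, h1,
        hb.2.1]) hb.2.2
    rw [mem_basicOpen]
    simp [hZ', hYρ, h0, h1, h2]
  obtain ⟨τ, hρτ, hτ⟩ := exists_large_extension (primrecPred_condTree_apply σ a) hrand
    (by rwa [treeClass_condTree]) (ε := (2 ^ (a.length + 3))⁻¹) (by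
      rw [ENNReal.inv_lt_one]
      exact_mod_cast Nat.one_lt_two_pow (by omega : a.length + 3 ≠ 0))
    (restrict Z m) (mem_basicOpen_restrict Z m)
  rw [treeClass_condTree] at hτ
  refine ⟨restrict Z m, τ, hσρ, by simpa using hm, hρτ, ?_,
    condClass_inter_nonempty hsub' (hσρ.trans hρτ) hτ⟩
  have h1 := measure_randTree_le hsub hσρ a.length le_rfl
    (by rw [List.take_length]; exact ⟨Z, hZ, mem_basicOpen_restrict Z m⟩)
  rw [List.take_length] at h1
  have h2 : measure (condClass σ a ∩ basicOpen (restrict Z m)) ≤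
      (2 ^ 3)⁻¹ * measure (basicOpen (restrict Z m)) := by
    refine (measure_mono hsmall).trans (le_of_eq ?_)
    rw [inv_two_pow_mul_measure_basicOpen, measure_basicOpen, List.length_append, add_comm]
    rfl
  -- The block of ones contributes `1/8` and all requirements together at most `1/4`.
  have h3 : ((2 : ℝ≥0∞) ^ 3)⁻¹ + (2 ^ 2)⁻¹ < (2 ^ 1)⁻¹ := by
    rw [← ENNReal.toReal_lt_toReal (by simp) (by simp), ENNReal.toReal_add (by simp) (by simp)]
    simp only [ENNReal.toReal_inv, ENNReal.toReal_pow, ENNReal.toReal_ofNat]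
    norm_num
  calc measure (treeClass randTree ∩ basicOpen (restrict Z m))
      ≤ ((2 ^ 3)⁻¹ + (2 ^ 2)⁻¹) * measure (basicOpen (restrict Z m)) := by
        rw [add_mul]
        exact h1.trans (add_le_add h2 (mul_le_mul_left (sum_inv_two_pow_le _) _))
    _ < (2 ^ 1)⁻¹ * measure (basicOpen (restrict Z m)) := by
        refine ENNReal.mul_lt_mul_left ?_ (measure_ne_top _ _) h3
        rw [measure_basicOpen]
        simp

/-! ### The steps of the construction and their approximations -/

theorem eventually_exists_lt_iff (p : ℕ → Prop) :
    ∀ᶠ s in atTop, ((∃ t < s, p t) ↔ ∃ t, p t) := by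
  by_cases h : ∃ t, p t
  · obtain ⟨t, ht⟩ := h
    filter_upwards [eventually_gt_atTop t] with s hs
    exact ⟨fun ⟨t, _, h⟩ => ⟨t, h⟩, fun _ => ⟨t, hs, ht⟩⟩
  · exact Eventually.of_forall fun s => ⟨fun ⟨t, _, ht⟩ => ⟨t, ht⟩, fun h' => absurd h' h⟩

/-- The next class is switched on, beyond a string at which `randTree` is sparse. -/
def SwitchOn (x y : List Bool × List Bool) : Prop :=
  y.2 = x.2 ++ [true] ∧ y.1.take x.1.length = x.1 ∧
    (∃ m ≤ y.1.length, x.1.length < m ∧ measure (treeClass randTree ∩ basicOpen (y.1.take m)) <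
      (2 ^ 1)⁻¹ * measure (basicOpen (y.1.take m))) ∧
    (condClass x.1 x.2 ∩ condClass y.1 y.2).Nonempty

/-- The class with the index of the last entry of `y.2` is avoided by `y.1` and switched off. -/
def SwitchOff (x y : List Bool × List Bool) : Prop :=
  y.2 = x.2.take (y.2.length - 1) ++ [false] ∧ x.2[y.2.length - 1]? ≠ some false ∧
    y.1.take x.1.length = x.1 ∧ x.1.length < y.1.length ∧
    (condClass x.1 (x.2.take (y.2.length - 1)) ∩ basicOpen y.1).Nonempty ∧
    treeClass (piTree (y.2.length - 1)) ∩ basicOpen y.1 = ∅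

/-- The approximation to `SwitchOn` at stage `s`. -/
def SwitchOnAt (x y : List Bool × List Bool) (s : ℕ) : Prop :=
  y.2 = x.2 ++ [true] ∧ y.1.take x.1.length = x.1 ∧
    (∃ t < s, ∃ m ≤ y.1.length, x.1.length < m ∧
      count (Good (restrTree randTree (y.1.take m))) t * 2 ^ (1 + (y.1.take m).length) < 2 ^ t) ∧
    ¬ ∃ t < s, count (Good fun v => condTree x.1 x.2 v ∧ condTree y.1 y.2 v) t = 0

/-- The approximation to `SwitchOff` at stage `s`. -/
def SwitchOffAt (x y : List Bool × List Bool) (s : ℕ) : Prop :=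
  y.2 = x.2.take (y.2.length - 1) ++ [false] ∧ x.2[y.2.length - 1]? ≠ some false ∧
    y.1.take x.1.length = x.1 ∧ x.1.length < y.1.length ∧
    (¬ ∃ t < s, count (Good (restrTree (condTree x.1 (x.2.take (y.2.length - 1))) y.1)) t = 0) ∧
    ∃ t < s, count (Good (restrTree (piTree (y.2.length - 1)) y.1)) t = 0

theorem eventually_switchOnAt_iff (x y : List Bool × List Bool) :
    ∀ᶠ s in atTop, (SwitchOnAt x y s ↔ SwitchOn x y) := by
  have h1 : (∃ m ≤ y.1.length, x.1.length < m ∧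
      measure (treeClass randTree ∩ basicOpen (y.1.take m)) <
        (2 ^ 1)⁻¹ * measure (basicOpen (y.1.take m))) ↔
      ∃ t, ∃ m ≤ y.1.length, x.1.length < m ∧
        count (Good (restrTree randTree (y.1.take m))) t * 2 ^ (1 + (y.1.take m).length) <
          2 ^ t := by
    simp only [measure_inter_lt_iff]
    constructor
    · rintro ⟨m, hm, hm', t, ht⟩
      exact ⟨t, m, hm, hm', ht⟩
    · rintro ⟨t, m, hm, hm', ht⟩
      exact ⟨m, hm, hm', t, ht⟩
  have h2 : (condClass x.1 x.2 ∩ condClass y.1 y.2).Nonempty ↔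
      ¬ ∃ t, count (Good fun v => condTree x.1 x.2 v ∧ condTree y.1 y.2 v) t = 0 := by
    rw [← treeClass_eq_empty_iff, Set.nonempty_iff_ne_empty, ← treeClass_condTree,
      ← treeClass_condTree]
    have : treeClass (condTree x.1 x.2) ∩ treeClass (condTree y.1 y.2) =
        treeClass fun v => condTree x.1 x.2 v ∧ condTree y.1 y.2 v := by
      ext X
      simp only [treeClass, Set.mem_inter_iff, Set.mem_ofPred_eq, forall_and]
    rw [this]
  unfold SwitchOnAt SwitchOn
  rw [h1, h2]
  filter_upwards [eventually_exists_lt_iff fun t => ∃ m ≤ y.1.length, x.1.length < m ∧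
        count (Good (restrTree randTree (y.1.take m))) t * 2 ^ (1 + (y.1.take m).length) < 2 ^ t,
    eventually_exists_lt_iff fun t =>
      count (Good fun v => condTree x.1 x.2 v ∧ condTree y.1 y.2 v) t = 0] with s hs1 hs2
  rw [hs1, hs2]

theorem eventually_switchOffAt_iff (x y : List Bool × List Bool) :
    ∀ᶠ s in atTop, (SwitchOffAt x y s ↔ SwitchOff x y) := by
  unfold SwitchOffAt SwitchOff
  rw [← not_not (a := (condClass x.1 _ ∩ _).Nonempty), Set.not_nonempty_iff_eq_empty,
    ← treeClass_condTree, ← treeClass_restrTree,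
    ← treeClass_restrTree, treeClass_eq_empty_iff,
    treeClass_eq_empty_iff]
  filter_upwards [eventually_exists_lt_iff fun t =>
      count (Good (restrTree (condTree x.1 (x.2.take (y.2.length - 1))) y.1)) t = 0,
    eventually_exists_lt_iff fun t =>
      count (Good (restrTree (piTree (y.2.length - 1)) y.1)) t = 0] with s hs1 hs2
  rw [hs1, hs2]

section Primrec

variable {α : Type} [Primcodable α]

theorem primrecPred_take_eq {f g : α → List Bool} (hf : Primrec f) (hg : Primrec g) :
    PrimrecPred fun x => (g x).take (f x).length = f x :=
  Primrec.eq.comp (Primrec.list_take.comp (Primrec.list_length.comp hf) hg) hf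

theorem primrecPred_exists_count_eq_zero {T : α → List Bool → Prop}
    (hT : PrimrecPred fun q : α × List Bool => T q.1 q.2) {s : α → ℕ} (hs : Primrec s) :
    PrimrecPred fun x => ∃ t < s x, count (Good (T x)) t = 0 :=
  primrecPred_exists_lt (p := fun x t => count (Good (T x)) t = 0)
    (Primrec.eq.comp (primrec_count_good hT) (Primrec.const 0)) hs

theorem primrecPred_restrTree_comp {β : Type} [Primcodable β] {T : β → List Bool → Prop}
    (hT : PrimrecPred fun q : β × List Bool => T q.1 q.2) {f : α → β} (hf : Primrec f)
    {g : α → List Bool} (hg : Primrec g) :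
    PrimrecPred fun q : α × List Bool => restrTree (T (f q.1)) (g q.1) q.2 :=
  (primrecPred_restrTree hT).comp
    (((hf.comp Primrec.fst).pair (hg.comp Primrec.fst)).pair Primrec.snd)

theorem primrecPred_condTree_comp {σ a v : α → List Bool} (hσ : Primrec σ) (ha : Primrec a)
    (hv : Primrec v) : PrimrecPred fun q => condTree (σ q) (a q) (v q) :=
  primrecPred_condTree.comp ((hσ.pair ha).pair hv)

theorem primrecPred_switchOnAt_comp {σ a τ b : α → List Bool} (hσ : Primrec σ) (ha : Primrec a)
    (hτ : Primrec τ) (hb : Primrec b) {s : α → ℕ} (hs : Primrec s) :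
    PrimrecPred fun q => SwitchOnAt (σ q, a q) (τ q, b q) (s q) := by
  have hlen {β : Type} [Primcodable β] {f : β → List Bool} (hf : Primrec f) :
      Primrec fun x => (f x).length := Primrec.list_length.comp hf
  refine PrimrecPred.and ?_ (PrimrecPred.and ?_ (PrimrecPred.and ?_ ?_))
  · exact Primrec.eq.comp hb (Primrec.list_append.comp ha (Primrec.const [true]))
  · exact primrecPred_take_eq hσ hτ
  · refine primrecPred_exists_lt (p := fun q t => ∃ m ≤ (τ q).length, (σ q).length < m ∧
      count (Good (restrTree randTree ((τ q).take m))) t * 2 ^ (1 + ((τ q).take m).length) <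
        2 ^ t) ?_ hs
    refine primrecPred_exists_le (p := fun (q : α × ℕ) m => (σ q.1).length < m ∧
      count (Good (restrTree randTree ((τ q.1).take m))) q.2 *
        2 ^ (1 + ((τ q.1).take m).length) < 2 ^ q.2) ?_ (hlen (hτ.comp Primrec.fst))
    have hfst : Primrec fun r : (α × ℕ) × ℕ => r.1.1 := Primrec.fst.comp Primrec.fst
    have htake : Primrec fun r : (α × ℕ) × ℕ => (τ r.1.1).take r.2 :=
      Primrec.list_take.comp Primrec.snd (hτ.comp hfst)
    refine PrimrecPred.and (Primrec.nat_lt.comp (hlen (hσ.comp hfst)) Primrec.snd) ?_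
    exact primrecPred_count_lt (β := Unit) (T := fun _ => randTree)
      (primrecPred_randTree.comp Primrec.snd) (Primrec.const ()) htake
      (Primrec.snd.comp Primrec.fst) (Primrec.nat_add.comp (Primrec.const 1) (hlen htake))
  · refine PrimrecPred.not (primrecPred_exists_count_eq_zero
      (T := fun q v => condTree (σ q) (a q) v ∧ condTree (τ q) (b q) v) ?_ hs)
    exact PrimrecPred.and
      (primrecPred_condTree_comp (hσ.comp Primrec.fst) (ha.comp Primrec.fst) Primrec.snd)
      (primrecPred_condTree_comp (hτ.comp Primrec.fst) (hb.comp Primrec.fst) Primrec.snd)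

theorem primrecPred_switchOffAt_comp {σ a τ b : α → List Bool} (hσ : Primrec σ) (ha : Primrec a)
    (hτ : Primrec τ) (hb : Primrec b) {s : α → ℕ} (hs : Primrec s) :
    PrimrecPred fun q => SwitchOffAt (σ q, a q) (τ q, b q) (s q) := by
  have hlen {f : α → List Bool} (hf : Primrec f) : Primrec fun x => (f x).length :=
    Primrec.list_length.comp hf
  have hj : Primrec fun q => (b q).length - 1 :=
    Primrec.nat_sub.comp (hlen hb) (Primrec.const 1)
  have htake : Primrec fun q => (a q).take ((b q).length - 1) := Primrec.list_take.comp hj ha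
  refine PrimrecPred.and ?_ (PrimrecPred.and ?_ (PrimrecPred.and ?_ (PrimrecPred.and ?_
    (PrimrecPred.and ?_ ?_))))
  · exact Primrec.eq.comp hb (Primrec.list_append.comp htake (Primrec.const [false]))
  · exact PrimrecPred.not (Primrec.eq.comp (Primrec.list_getElem?.comp ha hj)
      (Primrec.const (some false)))
  · exact primrecPred_take_eq hσ hτ
  · exact Primrec.nat_lt.comp (hlen hσ) (hlen hτ)
  · exact PrimrecPred.not (primrecPred_exists_count_eq_zero
      (T := fun q => restrTree (condTree (σ q) ((a q).take ((b q).length - 1))) (τ q))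
      (primrecPred_restrTree_comp
        (T := fun p : List Bool × List Bool => condTree p.1 p.2) primrecPred_condTree
        (hσ.pair htake) hτ) hs)
  · exact primrecPred_exists_count_eq_zero
      (T := fun q => restrTree (piTree ((b q).length - 1)) (τ q))
      (primrecPred_restrTree_comp primrecPred_piTree hj hτ) hs

end Primrec

theorem primrecPred_switchAt : PrimrecPred
    fun q : (List Bool × List Bool) × (List Bool × List Bool) × ℕ =>
      SwitchOnAt q.1 q.2.1 q.2.2 ∨ SwitchOffAt q.1 q.2.1 q.2.2 := by
  have hy : Primrec fun q : (List Bool × List Bool) × (List Bool × List Bool) × ℕ => q.2.1 :=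
    Primrec.fst.comp Primrec.snd
  have hσ := Primrec.fst.comp (Primrec.fst (α := List Bool × List Bool)
    (β := (List Bool × List Bool) × ℕ))
  have ha := Primrec.snd.comp (Primrec.fst (α := List Bool × List Bool)
    (β := (List Bool × List Bool) × ℕ))
  have hs : Primrec fun q : (List Bool × List Bool) × (List Bool × List Bool) × ℕ => q.2.2 :=
    Primrec.snd.comp Primrec.snd
  exact PrimrecPred.or
    (primrecPred_switchOnAt_comp hσ ha (Primrec.fst.comp hy) (Primrec.snd.comp hy) hs)
    (primrecPred_switchOffAt_comp hσ ha (Primrec.fst.comp hy) (Primrec.snd.comp hy) hs)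

/-! ### Existence of steps and their effect on conditions -/

theorem take_length_eq_of_prefix {σ τ : List Bool} (h : σ <+: τ) : τ.take σ.length = σ :=
  (List.prefix_iff_eq_take.1 h).symm

theorem prefix_of_take_length_eq {σ τ : List Bool} (h : τ.take σ.length = σ) : σ <+: τ :=
  h ▸ List.take_prefix _ _

/-- Either some class not yet off can be avoided, or all the inclusions needed by
`exists_sparse_extension` hold. The index `e = a.length`, where `a` has no entry, covers the class
about to be decided. -/
theorem exists_switch {x : List Bool × List Bool} (hx : (condClass x.1 x.2).Nonempty) :
    ∃ y, SwitchOn x y ∨ SwitchOff x y := by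
  obtain ⟨σ, a⟩ := x
  by_cases hoff : ∃ e ≤ a.length, a[e]? ≠ some false ∧
      ¬ condClass σ (a.take e) ⊆ treeClass (piTree e)
  · obtain ⟨e, he, hae, hsub⟩ := hoff
    obtain ⟨X, hX, hXe⟩ := Set.not_subset.1 hsub
    simp only [treeClass, Set.mem_ofPred_eq, not_forall] at hXe
    obtain ⟨n, hn⟩ := hXe
    have hlen : (a.take e ++ [false]).length - 1 = e := by simp [he]
    -- Long enough to show that `X` has left the class at height `n`, and strictly longer than `σ`.
    refine ⟨(restrict X (max n (σ.length + 1)), a.take e ++ [false]), Or.inr ?_⟩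
    refine ⟨by rw [hlen], by rw [hlen]; exact hae, take_length_eq_of_prefix
      (prefix_of_mem_basicOpen hX.1.2 (mem_basicOpen_restrict X _) (by simp)), by simp, ?_, ?_⟩
    · rw [hlen]
      exact ⟨X, hX, mem_basicOpen_restrict X _⟩
    · rw [hlen]
      refine Set.eq_empty_of_forall_notMem fun Y hY => hn ?_
      have h1 := hY.1 n
      have h2 := mem_basicOpen.1 hY.2
      rw [length_restrict] at h2
      rwa [← take_restrict Y (le_max_left _ _), h2, take_restrict X (le_max_left _ _)] at h1
  · push Not at hoff
    obtain ⟨ρ, τ, hσρ, hlt, hρτ, hm, hne⟩ := exists_sparse_extension hx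
      (fun e he => hoff e (List.getElem?_eq_some_iff.1 he).1.le (by simp [he]))
      (by simpa using hoff a.length le_rfl (by simp))
    refine ⟨(τ, a ++ [true]), Or.inl ⟨rfl, take_length_eq_of_prefix (hσρ.trans hρτ),
      ⟨ρ.length, hρτ.length_le, hlt, ?_⟩, hne⟩⟩
    simpa only [take_length_eq_of_prefix hρτ] using hm

theorem nonempty_of_switch {x y : List Bool × List Bool} (h : SwitchOn x y ∨ SwitchOff x y) :
    (condClass y.1 y.2).Nonempty := by
  rcases h with h | h
  · exact h.2.2.2.mono Set.inter_subset_right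
  · obtain ⟨hy, -, hp, -, hne, -⟩ := h
    rw [hy, condClass_append_false]
    exact hne.mono (condClass_subset_of_prefix (prefix_of_take_length_eq hp))

theorem prefix_of_switch {x y : List Bool × List Bool} (h : SwitchOn x y ∨ SwitchOff x y) :
    x.1 <+: y.1 ∧ x.1.length < y.1.length := by
  rcases h with ⟨-, h, ⟨m, hm, hm', -⟩, -⟩ | ⟨-, -, h, h', -⟩
  · exact ⟨prefix_of_take_length_eq h, by omega⟩
  · exact ⟨prefix_of_take_length_eq h, h'⟩

theorem SwitchOff.length_le {x y : List Bool × List Bool} (h : SwitchOff x y) :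
    y.2.length - 1 ≤ x.2.length ∧ y.2.length = (y.2.length - 1) + 1 := by
  have := congrArg List.length h.1
  simp only [List.length_append, List.length_take, List.length_singleton] at this
  omega

theorem SwitchOff.getElem?_eq {x y : List Bool × List Bool} (h : SwitchOff x y) (e : ℕ) :
    y.2[e]? = if e < y.2.length - 1 then x.2[e]? else
      if e = y.2.length - 1 then some false else none := by
  obtain ⟨h1, h2⟩ := h.length_le
  conv_lhs => rw [h.1]
  generalize y.2.length - 1 = j at h1
  have hl : (x.2.take j).length = j := by simp [h1]
  split_ifs with h3 h4
  · rw [List.getElem?_append_left (by omega), List.getElem?_take_of_lt h3]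
  · subst h4
    rw [List.getElem?_append_right (by omega), hl]
    simp
  · rw [List.getElem?_eq_none (by simp; omega)]

theorem SwitchOn.getElem?_eq {x y : List Bool × List Bool} (h : SwitchOn x y) (e : ℕ) :
    y.2[e]? = if e = x.2.length then some true else x.2[e]? := by
  rw [h.1]
  split_ifs with h1
  · simp [h1]
  · rcases lt_or_gt_of_ne h1 with h2 | h2
    · rw [List.getElem?_append_left h2]
    · rw [List.getElem?_eq_none (by simp; omega), List.getElem?_eq_none (by omega)]

/-- A sequence of strings that grow to a point of Cantor space. -/
theorem exists_mem_basicOpen {σ : ℕ → List Bool}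
    (h : ∀ k, σ k <+: σ (k + 1) ∧ (σ k).length < (σ (k + 1)).length) :
    ∃ X : Space, (∀ k, X ∈ basicOpen (σ k)) ∧ ∀ k, k ≤ (σ k).length := by
  have hlen : ∀ k, k ≤ (σ k).length := fun k => by
    induction k with
    | zero => simp
    | succ k ih => exact Nat.succ_le_of_lt (ih.trans_lt (h k).2)
  have hmono : ∀ k l, k ≤ l → σ k <+: σ l := fun k l hkl => by
    induction hkl with
    | refl => exact List.prefix_refl _
    | step _ ih => exact ih.trans (h _).1
  refine ⟨fun n => (σ (n + 1)).getD n false, fun k => restrict_eq_iff.2 fun i hi => ?_, hlen⟩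
  have hi' : i < (σ (i + 1)).length := hlen (i + 1)
  rw [List.getD_eq_getElem _ _ hi']
  rcases le_total k (i + 1) with hk | hk
  · exact ((hmono _ _ hk).getElem hi).symm
  · exact (hmono _ _ hk).getElem hi'

/-! ### Finite injury -/

/-- Once all entries below `e` are final, entry `e` is never cancelled. After it is filled, its only
possible change is from on to off, which is irreversible. -/
theorem exists_stable {st : ℕ → List Bool × List Bool}
    (h : ∀ k, SwitchOn (st k) (st (k + 1)) ∨ SwitchOff (st k) (st (k + 1)))
    (e : ℕ) : ∃ K b, ∀ k, K ≤ k → (st k).2[e]? = some b := by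
  suffices H : ∀ e, ∃ K, ∀ i < e, ∃ b, ∀ k, K ≤ k → (st k).2[i]? = some b by
    obtain ⟨K, hK⟩ := H (e + 1)
    exact ⟨K, hK e (Nat.lt_succ_self e)⟩
  intro e
  induction e with
  | zero => exact ⟨0, fun i hi => absurd hi (Nat.not_lt_zero i)⟩
  | succ e ih =>
    obtain ⟨K, hK⟩ := ih
    have hlenK : ∀ k, K ≤ k → e ≤ (st k).2.length := by
      intro k hk
      by_contra hcon
      obtain ⟨b, hb⟩ := hK (st k).2.length (not_le.1 hcon)
      have := hb k hk
      simp at this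
    -- Switching off a lower index would turn an entry that is not off into one that is, against its
    -- stability.
    have hj : ∀ k, K ≤ k → SwitchOff (st k) (st (k + 1)) → e ≤ (st (k + 1)).2.length - 1 := by
      intro k hk hoff
      by_contra hcon
      obtain ⟨b, hb⟩ := hK _ (not_le.1 hcon)
      have h1 := hoff.getElem?_eq ((st (k + 1)).2.length - 1)
      rw [if_neg (lt_irrefl _), if_pos rfl, hb (k + 1) (by omega), ← hb k hk] at h1
      exact hoff.2.1 h1
    have hlen : ∀ k, K + 1 ≤ k → e < (st k).2.length := by
      intro k hk
      obtain ⟨k, rfl⟩ : ∃ l, k = l + 1 := ⟨k - 1, by omega⟩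
      rcases h k with hon | hoff
      · have := hlenK k (by omega)
        rw [hon.1]
        simp
        omega
      · have := hj k (by omega) hoff
        have := hoff.length_le
        omega
    have hpers : ∀ k, K + 1 ≤ k → (st k).2[e]? = some false → (st (k + 1)).2[e]? = some false := by
      intro k hk hf
      rcases h k with hon | hoff
      · rw [hon.getElem?_eq, if_neg (hlen k hk).ne, hf]
      · rw [hoff.getElem?_eq]
        rcases (hj k (by omega) hoff).lt_or_eq with hlt | heq
        · rw [if_pos hlt, hf]
        · rw [if_neg (by omega), if_pos heq]
    by_cases hex : ∃ k₀, K + 1 ≤ k₀ ∧ (st k₀).2[e]? = some false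
    · obtain ⟨k₀, hk₀, hf⟩ := hex
      refine ⟨k₀, fun i hi => ?_⟩
      rcases Nat.lt_succ_iff_lt_or_eq.1 hi with hi' | rfl
      · obtain ⟨b, hb⟩ := hK i hi'
        exact ⟨b, fun k hk => hb k (by omega)⟩
      · refine ⟨false, fun k hk => ?_⟩
        induction hk with
        | refl => exact hf
        | step hk ih => exact hpers _ (hk₀.trans hk) ih
    · push Not at hex
      refine ⟨K + 1, fun i hi => ?_⟩
      rcases Nat.lt_succ_iff_lt_or_eq.1 hi with hi' | rfl
      · obtain ⟨b, hb⟩ := hK i hi'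
        exact ⟨b, fun k hk => hb k (by omega)⟩
      · refine ⟨true, fun k hk => ?_⟩
        have h1 := hex k hk
        rw [List.getElem?_eq_getElem (hlen k hk)] at h1 ⊢
        simpa using h1

theorem switched_off_disjoint {st : ℕ → List Bool × List Bool} (h0 : st 0 = ([], []))
    (h : ∀ k, SwitchOn (st k) (st (k + 1)) ∨ SwitchOff (st k) (st (k + 1))) (k e : ℕ)
    (hf : (st k).2[e]? = some false) :
    treeClass (piTree e) ∩ basicOpen (st k).1 = ∅ := by
  induction k with
  | zero => simp [h0] at hf
  | succ k ih =>
    have hsub : treeClass (piTree e) ∩ basicOpen (st (k + 1)).1 ⊆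
        treeClass (piTree e) ∩ basicOpen (st k).1 :=
      Set.inter_subset_inter_right _ (basicOpen_anti (prefix_of_switch (h k)).1)
    rcases h k with hon | hoff
    · rw [hon.getElem?_eq] at hf
      split_ifs at hf
      · simp at hf
      · exact Set.subset_empty_iff.1 (ih hf ▸ hsub)
    · rw [hoff.getElem?_eq] at hf
      split_ifs at hf with h1 h2
      · exact Set.subset_empty_iff.1 (ih hf ▸ hsub)
      · rw [h2]
        exact hoff.2.2.2.2.2

theorem exists_stable_true {st : ℕ → List Bool × List Bool} (h0 : st 0 = ([], []))
    (h : ∀ k, SwitchOn (st k) (st (k + 1)) ∨ SwitchOff (st k) (st (k + 1))) {X : Space}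
    (hX : ∀ k, X ∈ basicOpen (st k).1) {e : ℕ} (hXe : X ∈ treeClass (piTree e)) :
    ∃ K, ∀ k, K ≤ k → (st k).2[e]? = some true := by
  obtain ⟨K, b, hb⟩ := exists_stable h e
  cases b with
  | true => exact ⟨K, hb⟩
  | false =>
    have := switched_off_disjoint h0 h K e (hb K le_rfl)
    exact absurd (this ▸ ⟨hXe, hX K⟩ : X ∈ (∅ : Set Space)) (Set.notMem_empty X)

/-- After a tail of `SwitchOff` steps no new entry could become on, yet `X` lies in a class with
indices as large as desired, each of which must end up on. -/
theorem exists_switchOn {st : ℕ → List Bool × List Bool} (h0 : st 0 = ([], []))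
    (h : ∀ k, SwitchOn (st k) (st (k + 1)) ∨ SwitchOff (st k) (st (k + 1))) {X : Space}
    (hX : ∀ k, X ∈ basicOpen (st k).1) {c : ℕ} (hXc : X ∈ treeClass (enumTree c)) (N : ℕ) :
    ∃ k, N ≤ k ∧ SwitchOn (st k) (st (k + 1)) := by
  by_contra! hcon
  -- An index of the same class that is at least the length of the current list, hence undecided at
  -- `N`.
  set e := Nat.pair c (st N).2.length
  obtain ⟨K, hK⟩ := exists_stable_true h0 h hX (e := e) (by simpa [piTree, e] using hXc)
  have hne : ∀ k, N ≤ k → (st k).2[e]? ≠ some true := by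
    intro k hk
    induction hk with
    | refl =>
      rw [List.getElem?_eq_none (Nat.right_le_pair _ _)]
      simp
    | step hk ih =>
      rw [((h _).resolve_left (hcon _ hk)).getElem?_eq]
      split_ifs
      · exact ih
      · simp
      · simp
  exact hne (max N K) (le_max_left _ _) (hK _ (le_max_right _ _))

/-! ### Lower densities along the limit point -/

/-- A class that stays switched on keeps its relative measure between two consecutive strings. -/
theorem le_measure_of_switch {x y : List Bool × List Bool} (h : SwitchOn x y ∨ SwitchOff x y)
    {e : ℕ} (hx : x.2[e]? = some true) (hy : y.2[e]? = some true) {X : Space}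
    (hX : X ∈ basicOpen y.1) {m : ℕ} (hm : x.1.length ≤ m) (hm' : m ≤ y.1.length) :
    (2 ^ (e + 3))⁻¹ * measure (basicOpen (restrict X m)) ≤
      measure (treeClass (piTree e) ∩ basicOpen (restrict X m)) := by
  -- Either kind of step supplies a path obeying the old requirement on `e` and passing through the
  -- new string; it agrees with `X` at all levels in question.
  obtain ⟨Y, b, hY, hb, hYy⟩ : ∃ Y b, Y ∈ condClass x.1 b ∧ b[e]? = some true ∧
      Y ∈ basicOpen y.1 := by
    rcases h with hon | hoff
    · obtain ⟨Y, hY, hY'⟩ := hon.2.2.2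
      exact ⟨Y, x.2, hY, hx, hY'.1.2⟩
    · obtain ⟨Y, hY, hY'⟩ := hoff.2.2.2.2.1
      refine ⟨Y, _, hY, ?_, hY'⟩
      rw [hoff.getElem?_eq] at hy
      split_ifs at hy with h1 h2
      · rwa [List.getElem?_take_of_lt h1]
      · simp at hy
  have hXY : restrict Y m = restrict X m := by
    rw [← take_restrict Y hm', ← take_restrict X hm', mem_basicOpen.1 hX, mem_basicOpen.1 hYy]
  rw [← hXY]
  exact hY.2 e hb m hm

theorem lowerDensity_pos {st : ℕ → List Bool × List Bool} (h0 : st 0 = ([], []))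
    (h : ∀ k, SwitchOn (st k) (st (k + 1)) ∨ SwitchOff (st k) (st (k + 1))) {X : Space}
    (hX : ∀ k, X ∈ basicOpen (st k).1) (hlen : ∀ k, k ≤ (st k).1.length) {c : ℕ}
    (hXc : X ∈ treeClass (enumTree c)) : 0 < lowerDensity (treeClass (enumTree c)) X := by
  set e := Nat.pair c 0
  have hc : treeClass (piTree e) = treeClass (enumTree c) := by simp [piTree, e]
  obtain ⟨K, hK⟩ := exists_stable_true h0 h hX (e := e) (hc ▸ hXc)
  refine lt_of_lt_of_le (b := ((2 : ℝ≥0∞) ^ (e + 3))⁻¹) (by simp) ?_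
  refine le_liminf_of_le (h := ?_)
  filter_upwards [eventually_ge_atTop (st K).1.length] with m hm
  have hex : ∃ k, m < (st (k + 1)).1.length := ⟨m, hlen (m + 1)⟩
  classical
  -- Every level beyond the `K`-th string falls between two consecutive strings, so one step
  -- controls it.
  obtain ⟨k, hk, hkm, hkm'⟩ : ∃ k, K ≤ k ∧ (st k).1.length ≤ m ∧ m < (st (k + 1)).1.length := by
    by_contra! hcon
    have : ∀ k, K ≤ k → (st k).1.length ≤ m := fun k hk => by
      induction hk with
      | refl => exact hm
      | step hk ih => exact hcon _ hk ih
    have h1 := this (max K (m + 1)) (le_max_left _ _)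
    have h2 := hlen (max K (m + 1))
    omega
  rw [relMeasure, ENNReal.le_div_iff_mul_le (Or.inl (by rw [measure_basicOpen]; simp))
    (Or.inl (measure_ne_top _ _)), ← hc]
  exact le_measure_of_switch (h k) (hK k hk) (hK _ (by omega)) (hX _) hkm hkm'.le

theorem lowerDensity_randTree_le {st : ℕ → List Bool × List Bool} {X : Space}
    (hX : ∀ k, X ∈ basicOpen (st k).1) (hlen : ∀ k, k ≤ (st k).1.length)
    (hon : ∀ N, ∃ k, N ≤ k ∧ SwitchOn (st k) (st (k + 1))) :
    lowerDensity (treeClass randTree) X ≤ 1 / 2 := by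
  refine liminf_le_of_frequently_le (frequently_atTop.2 fun N => ?_)
  obtain ⟨k, hk, -, -, ⟨m, hm, hm', hlt⟩, -⟩ := hon N
  refine ⟨m, by have := hlen k; omega, ?_⟩
  rw [← mem_basicOpen.1 (hX (k + 1)), take_restrict X hm] at hlt
  refine ENNReal.div_le_of_le_mul (hlt.le.trans (le_of_eq ?_))
  simp

end Cantor

end

theorem mainTheorem4 :
    ∃ X : Cantor.Space,
      Cantor.IsDelta02 {n : ℕ | X n = true} ∧
      Cantor.IsMLRandom X ∧
      (∃ P : Set Cantor.Space, Cantor.IsPi01Class P ∧ (∀ Y ∈ P, Cantor.IsMLRandom Y) ∧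
        X ∈ P ∧ Cantor.lowerDensity P X ≤ 1 / 2) ∧
      ¬ Cantor.IsDensityOnePoint X ∧
      Cantor.IsPositiveDensityPoint X := by
  open Cantor in
  obtain ⟨st, h0, hne, h, g, hg, hlim⟩ := exists_limit_sequence
    (Ds := fun x y s => SwitchOnAt x y s ∨ SwitchOffAt x y s) primrecPred_switchAt
    (D := fun x y => SwitchOn x y ∨ SwitchOff x y)
    (fun x y => by
      filter_upwards [eventually_switchOnAt_iff x y, eventually_switchOffAt_iff x y] with s h1 h2
      rw [h1, h2])
    (Inv := fun x => (condClass x.1 x.2).Nonempty) (fun x hx => exists_switch hx)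
    (fun x y _ hxy => nonempty_of_switch hxy) (x₀ := ([], [])) (by
      obtain ⟨X, hX⟩ := treeClass_randTree_nonempty
      exact ⟨X, ⟨hX, rfl⟩, by simp⟩)
  obtain ⟨X, hX, hlen⟩ := exists_mem_basicOpen fun k => prefix_of_switch (h k)
  -- The `n`-th condition has a path in `randTree`, and that path agrees with `X` up to `n`.
  have hXP : X ∈ treeClass randTree := fun n => by
    obtain ⟨Y, hY⟩ := hne n
    have hYX : restrict Y n = restrict X n := by
      rw [← take_restrict Y (hlen n), ← take_restrict X (hlen n), mem_basicOpen.1 (hX n),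
        mem_basicOpen.1 hY.1.2]
    exact hYX ▸ hY.1.1 n
  have hP : IsPi01Class (treeClass randTree) := isPi01Class_treeClass primrecPred_randTree
  have hhalf : lowerDensity (treeClass randTree) X ≤ 1 / 2 := by
    obtain ⟨c, hc⟩ := hP.exists_enumTree
    exact lowerDensity_randTree_le hX hlen (exists_switchOn h0 h hX (hc ▸ hXP))
  refine ⟨X, ?_, isMLRandom_of_mem_randTree hXP, ⟨treeClass randTree, hP,
    fun Y hY => isMLRandom_of_mem_randTree hY, hXP, hhalf⟩, fun hone => ?_, fun S hS hXS => ?_⟩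
  · refine isDelta02_of_limit (p := fun n s => (g (n + 1) s).1[n]? = some true) ?_ fun n => ?_
    · exact Primrec.eq.comp (Primrec.list_getElem?.comp (Primrec.fst.comp
        (hg.comp (Primrec.succ.comp Primrec.fst) Primrec.snd)) Primrec.fst) (Primrec.const _)
    · filter_upwards [hlim (n + 1)] with s hs
      have hn : n < (st (n + 1)).1.length := hlen (n + 1)
      rw [hs, List.getElem?_eq_getElem hn, ← restrict_eq_iff.1 (hX (n + 1)) n hn]
      simp
  · rw [hone _ hP hXP] at hhalf
    exact absurd hhalf (by simp)
  · obtain ⟨c, rfl⟩ := hS.exists_enumTree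
    exact lowerDensity_pos h0 h hX hlen hXS
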